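/- Let $V$ be a real inner product space of finite dimension $n$, let $E\subset V$ be a finite set of unit vectors, no two of them linearly dependent, and let $\mathcal H=\{H_e\}_{e\in E}$, $H_e=\{x\in V:(e,x)=0\}$, be the corresponding central hyperplane arrangement, with $|\mathcal H|=|E|$. A chamber is a connected component of $V\setminus\bigcup_{e\in E}H_e$; let $\mathscr T$ be the set of chambers. Assume that there is a base chamber $T_0\in\mathscr T$ on which all $e\in E$ are positive, and let $(-1)^T=(-1)^{|S(T_0,T)|}$, where $S(T_0,T)$ is the set of $e\in E$ such that $T_0$ and $T$ lie on different sides of $H_e$. Let $\mathbb B(a,R)$ be the closed ball with center $a$ and radius $R$, let $P(\mathcal H,K)=\sum_{T\in\mathscr T}(-1)^T\,\mathrm{Vol}(K\cap T)$, and let $\mathrm{Vol}_{n-1}(\partial X)$ be the $(n-1)$-dimensional (Hausdorff) measure of the boundary of $X$, normalized to agree with Lebesgue measure on hyperplanes (and equal to $0$ if $n=0$). (1) Let $a\in V$. If $P(\mathcal H,\mathbb B(a,R))$ does not depend on $R\ge\|a\|$, then for every $R\ge\|a\|$ the surface volumes below are finite and $$\sum_{T\in\mathscr T}(-1)^T\,\mathrm{Vol}_{n-1}\bigl(\partial(\mathbb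 B(a,R)\cap\overline T)\bigr)=0 .$$ (2) Suppose that $\mathcal H$ satisfies the parity condition, that is, $|\mathcal H|\equiv\dim V\pmod 2$, and that it contains a Coxeter arrangement $\mathcal H'\subseteq\mathcal H$ (the group $W$ generated by the orthogonal reflections in the hyperplanes of $\mathcal H'$ is finite, and $\mathcal H'$ is stable under these reflections) such that $W$ preserves $\mathcal H$ and $|\mathcal H'|\ge\dim V$. Then for all $a\in V$ and $R\ge\|a\|$ the surface volumes are finite and the same identity holds. In both parts the degenerate case $n=1$, $R=\|a\|>0$ is excluded (there, if $\mathcal H=\{\{0\}\}$, one of the two regions is a single point rather than a segment). -/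

import Mathlib

open MeasureTheory Module
open scoped RealInnerProductSpace

noncomputable section

namespace Pizza

variable {V : Type*} [NormedAddCommGroup V] [InnerProductSpace ℝ V]

/-- The linear hyperplane `{x | ⟪e, x⟫ = 0}` with normal vector `e`. -/
def hyperplane (e : V) : Submodule ℝ V := (ℝ ∙ e)ᗮ

/-- The central hyperplane arrangement indexed by a finite set `E` of normal vectors. -/
def hyperplanes (E : Finset V) : Set (Submodule ℝ V) := hyperplane '' (E : Set V)

/-- The complement in `V` of the union of the hyperplanes. -/
def complement (E : Finset V) : Set V := {x | ∀ e ∈ E, x ∉ hyperplane e}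

/-- The chambers: the connected components of the complement of the arrangement. -/
def chambers (E : Finset V) : Set (Set V) :=
  (connectedComponentIn (complement E)) '' (complement E)

/-- The two sets lie strictly on different sides of the hyperplane with normal vector `e`. -/
def OppositeSides (e : V) (S T : Set V) : Prop :=
  ((∀ x ∈ S, 0 < ⟪e, x⟫) ∧ (∀ y ∈ T, ⟪e, y⟫ < 0)) ∨
    ((∀ x ∈ S, ⟪e, x⟫ < 0) ∧ (∀ y ∈ T, 0 < ⟪e, y⟫))

open Classical in
/-- The separation set `S(T₁, T₂)` of two chambers. -/
def separationSet (E : Finset V) (T₁ T₂ : Set V) : Finset V :=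
  E.filter (fun e => OppositeSides e T₁ T₂)

theorem mem_hyperplane_iff (e x : V) : x ∈ hyperplane e ↔ ⟪e, x⟫ = 0 :=
  Submodule.mem_orthogonal_singleton_iff_inner_right

/-- A finite central arrangement has finitely many chambers. -/
theorem chambers_finite (E : Finset V) : (chambers E).Finite := by
  classical
  -- a chamber is determined by the set of normals that are positive on it
  let C : Finset V → Set V := fun P =>
    {x | ∀ e ∈ E, (e ∈ P → 0 < ⟪e, x⟫) ∧ (e ∉ P → ⟪e, x⟫ < 0)}
  have hconv : ∀ P, IsPreconnected (C P) := by
    intro P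
    refine Convex.isPreconnected ?_
    intro x hx y hy s t hs ht hst e he
    rw [inner_add_right, inner_smul_right, inner_smul_right]
    obtain ⟨hx1, hx2⟩ := hx e he
    obtain ⟨hy1, hy2⟩ := hy e he
    rcases hs.eq_or_lt with h0 | h0
    · have h1 : t = 1 := by linarith
      subst h0 h1
      simpa using ⟨hy1, hy2⟩
    · constructor
      · intro h
        nlinarith [mul_pos h0 (hx1 h), mul_nonneg ht (hy1 h).le]
      · intro h
        nlinarith [mul_pos h0 (neg_pos.2 (hx2 h)), mul_nonneg ht (neg_pos.2 (hy2 h)).le]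
  have hsub : ∀ P, C P ⊆ complement E := by
    intro P x hx e he hxe
    rw [mem_hyperplane_iff] at hxe
    obtain ⟨h1, h2⟩ := hx e he
    by_cases h : e ∈ P
    · exact absurd hxe (h1 h).ne'
    · exact absurd hxe (h2 h).ne
  let sgn : V → Finset V := fun x => E.filter (fun e => 0 < ⟪e, x⟫)
  have hmem : ∀ x ∈ complement E, x ∈ C (sgn x) := by
    intro x hx e he
    have hne : ⟪e, x⟫ ≠ 0 := fun h => hx e he ((mem_hyperplane_iff e x).2 h)
    refine ⟨fun h => (Finset.mem_filter.1 h).2, fun h => ?_⟩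
    have h' : ¬ 0 < ⟪e, x⟫ := fun hp => h (Finset.mem_filter.2 ⟨he, hp⟩)
    exact lt_of_le_of_ne (not_lt.1 h') hne
  have key : ∀ x ∈ complement E, ∀ y ∈ complement E, sgn x = sgn y →
      connectedComponentIn (complement E) x = connectedComponentIn (complement E) y := by
    intro x hx y hy hxy
    have hy' : y ∈ C (sgn x) := by rw [hxy]; exact hmem y hy
    exact connectedComponentIn_eq
      ((hconv (sgn x)).subset_connectedComponentIn (hmem x hx) (hsub _) hy')
  have hfin : (sgn '' complement E).Finite := by
    refine Set.Finite.subset (E.powerset.finite_toSet) ?_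
    rintro _ ⟨x, -, rfl⟩
    exact Finset.mem_coe.2 (Finset.mem_powerset.2 (Finset.filter_subset _ _))
  obtain ⟨s, hs, hs'⟩ := Set.exists_subset_bijOn (complement E) sgn
  have hsfin : s.Finite := by
    refine Set.Finite.of_finite_image ?_ hs'.injOn
    rw [hs'.image_eq]
    exact hfin
  refine (hsfin.image (connectedComponentIn (complement E))).subset ?_
  rintro _ ⟨x, hx, rfl⟩
  obtain ⟨y, hy, hyx⟩ := hs'.surjOn ⟨x, hx, rfl⟩
  exact ⟨y, hy, key y (hs hy) x hx hyx⟩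

/-- A finite central hyperplane arrangement in `V` with a base chamber: a finite set of unit
normal vectors, no two of them linearly dependent, all pointing to the side of the base
chamber. -/
structure Arrangement (V : Type*) [NormedAddCommGroup V] [InnerProductSpace ℝ V] where
  /-- the unit normal vectors, one for each hyperplane -/
  normals : Finset V
  norm_eq_one : ∀ e ∈ normals, ‖e‖ = 1
  neg_notMem : ∀ e ∈ normals, -e ∉ normals
  /-- the base chamber -/
  base : Set V
  base_mem : base ∈ chambers normals
  base_pos : ∀ e ∈ normals, ∀ x ∈ base, 0 < ⟪e, x⟫

namespace Arrangement

/-- The finite set of chambers. -/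
def chamberFinset (H : Arrangement V) : Finset (Set V) := (chambers_finite H.normals).toFinset

/-- The sign `(-1)^T` of a chamber: `-1` to the number of hyperplanes that separate it from the
base chamber. -/
def sign (H : Arrangement V) (T : Set V) : ℝ := (-1) ^ (separationSet H.normals H.base T).card

/-- The number of hyperplanes has the same parity as the dimension. -/
def ParityCondition (H : Arrangement V) : Prop := H.normals.card ≡ finrank ℝ V [MOD 2]

variable [FiniteDimensional ℝ V] [MeasurableSpace V] [BorelSpace V]

/-- The pizza quantity: the alternating sum over the chambers of the volumes `Vol(K ∩ T)`. -/
def pizzaQuantity (H : Arrangement V) (K : Set V) : ℝ :=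
  ∑ T ∈ H.chamberFinset, H.sign T * volume.real (K ∩ T)

end Arrangement

/-- The group generated by the orthogonal reflections in the hyperplanes with normals in `E`. -/
def reflectionGroup [FiniteDimensional ℝ V] (E : Finset V) : Subgroup (V ≃ₗᵢ[ℝ] V) :=
  Subgroup.closure ((fun e => (hyperplane e).reflection) '' (E : Set V))

/-- The isometry `w` maps every hyperplane of the arrangement to a hyperplane of it. -/
def Preserves (w : V ≃ₗᵢ[ℝ] V) (E : Finset V) : Prop :=
  ∀ L ∈ hyperplanes E, L.map (w.toLinearEquiv : V →ₗ[ℝ] V) ∈ hyperplanes E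

/-- A Coxeter arrangement: the reflections in its hyperplanes generate a finite group, and each
of them maps the arrangement to itself. -/
def IsCoxeter [FiniteDimensional ℝ V] (E : Finset V) : Prop :=
  Finite (reflectionGroup E) ∧ ∀ e ∈ E, Preserves (hyperplane e).reflection E

variable [FiniteDimensional ℝ V] [MeasurableSpace V] [BorelSpace V]

/-- The surface measure `Vol_{n-1}(∂X)`, with `n = dim V`: the Hausdorff measure of dimension
`n - 1`, normalized so as to extend Lebesgue measure on hyperplanes, of the boundary of `X`.
(For `n = 0` the boundary is empty, and the value is `0`.) -/
def surfaceMeasure (X : Set V) : ENNReal :=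
  Measure.euclideanHausdorffMeasure (finrank ℝ V - 1) (frontier X)

/-- The alternating sum over all chambers `T` of the surface volumes `Vol_{n-1}(∂(𝔹(a,R) ∩ T̄))`
is zero, all of these surface volumes being finite. -/
def Arrangement.AlternatingSurfaceSumVanishes (H : Arrangement V) (a : V) (R : ℝ) : Prop :=
  (∀ T ∈ H.chamberFinset, surfaceMeasure (Metric.closedBall a R ∩ closure T) < ⊤) ∧
    ∑ T ∈ H.chamberFinset,
      H.sign T * (surfaceMeasure (Metric.closedBall a R ∩ closure T)).toReal = 0

end Pizza

end

/-! On each chamber the sign `(-1)^T` equals the sign of the product of the linear forms, so every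
alternating sum over chambers is an integral of `signProd`. The boundary of a ball cut by a closed
chamber consists of a flat part in the hyperplanes and a spherical part.

The flat parts cancel for every arrangement: up to a null set, a flat point lies on one hyperplane
only and borders exactly two chambers, of opposite signs (`sum_sign_indicator_closure`,
`sum_sign_flat_part`).

The spherical parts add up to a multiple of the derivative in `R` of the pizza quantity of the ball,
so they cancel when that quantity is constant (`sphericalIntegral_eq_zero`). The derivative is taken
in polar coordinates about `a`, whose measure on directions is `toSphere`; it is proportional to the
Hausdorff measure of the sphere because both are finite and rotation invariant
(`exists_eq_smul_of_uniform`).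

Part (2) follows from part (1) once the pizza quantity is shown to be constant. Polar coordinates
about the origin give the ball the radius `t + √(t² + c)` in direction `u`, where `t = ⟪a, u⟫` and
`c = R² - ‖a‖²`. Parity allows pairing `u` with `-u`, which turns the `n`-th power of the radius
into `(2t)^n` plus a polynomial in `t` of degree below `n` (`exists_polynomial_add_pow`). The
moments of degree below `n` vanish, since as functions of `a` they are polynomials of that degree
vanishing on at least `n` hyperplanes (`sphereMoment_eq_zero`). Only the `n`-th moment is left, and
it does not involve `R`. -/

noncomputable section

namespace Pizza

/-! ### Chambers as sign cells, and alternating sums as integrals of a sign. -/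

section Chambers

variable {V : Type*} [NormedAddCommGroup V] [InnerProductSpace ℝ V]

/-- The product of the linear forms defining the hyperplanes of an arrangement. -/
def normalProd (E : Finset V) (x : V) : ℝ := ∏ e ∈ E, ⟪e, x⟫

/-- The sign of the product of the linear forms defining the hyperplanes. -/
def signProd (E : Finset V) (x : V) : ℝ := (SignType.sign (normalProd E x) : ℝ)

/-- The points strictly on the same side as `z` of all hyperplanes. -/
def chamberAt (E : Finset V) (z : V) : Set V := {y | ∀ e ∈ E, 0 < ⟪e, z⟫ * ⟪e, y⟫}

theorem continuous_normalProd (E : Finset V) : Continuous (normalProd E) := by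
  unfold normalProd
  fun_prop

theorem normalProd_eq_zero_iff {E : Finset V} {x : V} :
    normalProd E x = 0 ↔ ∃ e ∈ E, ⟪e, x⟫ = 0 := Finset.prod_eq_zero_iff

theorem mem_complement_iff {E : Finset V} {x : V} :
    x ∈ complement E ↔ ∀ e ∈ E, ⟪e, x⟫ ≠ 0 := by
  simp [complement, mem_hyperplane_iff]

theorem signProd_eq_zero_of_notMem {E : Finset V} {x : V} (hx : x ∉ complement E) :
    signProd E x = 0 := by
  rw [mem_complement_iff] at hx
  push Not at hx
  simp [signProd, normalProd_eq_zero_iff.2 hx]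

theorem abs_signProd_le_one (E : Finset V) (x : V) : |signProd E x| ≤ 1 := by
  unfold signProd
  cases SignType.sign (normalProd E x) <;> simp

theorem isOpen_chamberAt (E : Finset V) (z : V) : IsOpen (chamberAt E z) := by
  have : chamberAt E z = ⋂ e ∈ E, {y | 0 < ⟪e, z⟫ * ⟪e, y⟫} := by
    ext; simp [chamberAt]
  rw [this]
  exact isOpen_biInter_finset fun e _ => isOpen_lt continuous_const (by fun_prop)

theorem convex_chamberAt (E : Finset V) (z : V) : Convex ℝ (chamberAt E z) := by
  intro x hx y hy s t hs ht hst e he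
  have h1 := hx e he
  have h2 := hy e he
  rw [inner_add_right, inner_smul_right, inner_smul_right]
  rcases hs.eq_or_lt with h0 | h0
  · have : t = 1 := by linarith
    subst h0 this
    simpa using h2
  · nlinarith [mul_pos h0 h1, mul_nonneg ht h2.le]

theorem self_mem_chamberAt {E : Finset V} {z : V} (hz : z ∈ complement E) :
    z ∈ chamberAt E z := fun e he => mul_self_pos.2 (mem_complement_iff.1 hz e he)

theorem chamberAt_subset_complement (E : Finset V) (z : V) : chamberAt E z ⊆ complement E :=
  fun _ hy => mem_complement_iff.2 fun e he h => by simpa [h] using hy e he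

/-- The sign cell is convex, hence connected; conversely, by the intermediate value theorem, no
linear form can change sign on a connected set avoiding its zeros. -/
theorem connectedComponentIn_complement {E : Finset V} {z : V} (hz : z ∈ complement E) :
    connectedComponentIn (complement E) z = chamberAt E z := by
  refine Set.Subset.antisymm (fun y hy e he => ?_)
    ((convex_chamberAt E z).isPreconnected.subset_connectedComponentIn (self_mem_chamberAt hz)
      (chamberAt_subset_complement E z))
  by_contra hneg
  have hconn : IsPreconnected ((fun y => ⟪e, z⟫ * ⟪e, y⟫) ''
      connectedComponentIn (complement E) z) :=
    isPreconnected_connectedComponentIn.image _ (by fun_prop)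
  have hzz := self_mem_chamberAt hz e he
  obtain ⟨w, hw, hw0⟩ := hconn.ordConnected.out ⟨y, hy, rfl⟩
    ⟨z, mem_connectedComponentIn hz, rfl⟩ (show (0 : ℝ) ∈ Set.Icc _ _ from ⟨not_lt.1 hneg, hzz.le⟩)
  have hwc := mem_complement_iff.1 (connectedComponentIn_subset _ _ hw) e he
  have hzc := mem_complement_iff.1 hz e he
  exact mul_ne_zero hzc hwc hw0

theorem mem_chambers_iff {E : Finset V} {T : Set V} :
    T ∈ chambers E ↔ ∃ z ∈ complement E, chamberAt E z = T := by
  constructor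
  · rintro ⟨z, hz, rfl⟩
    exact ⟨z, hz, (connectedComponentIn_complement hz).symm⟩
  · rintro ⟨z, hz, rfl⟩
    exact ⟨z, hz, connectedComponentIn_complement hz⟩

theorem mul_pos_iff_neg_of_neg {a b : ℝ} (ha : a < 0) : 0 < a * b ↔ b < 0 := by
  rw [mul_pos_iff]
  simp [ha, ha.not_gt]

theorem chamberAt_eq_of_mem {E : Finset V} {y z : V} (hy : y ∈ chamberAt E z) :
    chamberAt E y = chamberAt E z := by
  ext x
  refine forall₂_congr fun e he => ?_
  have h := hy e he
  rcases lt_or_gt_of_ne (left_ne_zero_of_mul h.ne') with h1 | h1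
  · have h2 : ⟪e, y⟫ < 0 := by nlinarith
    rw [mul_pos_iff_neg_of_neg h1, mul_pos_iff_neg_of_neg h2]
  · have h2 : 0 < ⟪e, y⟫ := (mul_pos_iff_of_pos_left h1).1 h
    rw [mul_pos_iff_of_pos_left h1, mul_pos_iff_of_pos_left h2]

theorem closure_chamberAt {E : Finset V} {z : V} (hz : z ∈ complement E) :
    closure (chamberAt E z) = {y | ∀ e ∈ E, 0 ≤ ⟪e, z⟫ * ⟪e, y⟫} := by
  refine Set.Subset.antisymm (closure_minimal (fun y hy e he => (hy e he).le) ?_) fun y hy => ?_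
  · have : {y | ∀ e ∈ E, 0 ≤ ⟪e, z⟫ * ⟪e, y⟫} = ⋂ e ∈ E, {y | 0 ≤ ⟪e, z⟫ * ⟪e, y⟫} := by
      ext; simp
    rw [this]
    exact isClosed_biInter fun e _ => isClosed_le continuous_const (by fun_prop)
  -- Moving from `y` in the direction `z` makes all the weak inequalities strict at once.
  · have hlim : Filter.Tendsto (fun t : ℝ => y + t • z) (nhdsWithin 0 (Set.Ioi 0)) (nhds y) := by
      have : Continuous fun t : ℝ => y + t • z := by fun_prop
      simpa using (this.tendsto 0).mono_left nhdsWithin_le_nhds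
    refine mem_closure_of_tendsto hlim (eventually_mem_nhdsWithin.mono fun t ht e he => ?_)
    have h1 := self_mem_chamberAt hz e he
    rw [inner_add_right, inner_smul_right, mul_add]
    have : 0 < ⟪e, z⟫ * (t * ⟪e, z⟫) := by
      have := mul_pos (Set.mem_Ioi.1 ht) h1
      linarith
    exact add_pos_of_nonneg_of_pos (hy e he) this

theorem interior_closure_chamberAt {E : Finset V} {z : V} (hz : z ∈ complement E) :
    interior (closure (chamberAt E z)) = chamberAt E z := by
  rw [(convex_chamberAt E z).interior_closure_eq_interior_of_nonempty_interior,
    (isOpen_chamberAt E z).interior_eq]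
  rw [(isOpen_chamberAt E z).interior_eq]
  exact ⟨z, self_mem_chamberAt hz⟩

namespace Arrangement

variable (H : Arrangement V)

theorem mem_chamberFinset {T : Set V} :
    T ∈ H.chamberFinset ↔ ∃ z ∈ complement H.normals, chamberAt H.normals z = T := by
  simp [chamberFinset, mem_chambers_iff]

theorem normal_ne_zero {e : V} (he : e ∈ H.normals) : e ≠ 0 := by
  intro h
  simpa [h] using H.norm_eq_one e he

theorem exists_base_point : ∃ b, ∀ e ∈ H.normals, 0 < ⟪e, b⟫ := by
  obtain ⟨z, hz, h⟩ := mem_chambers_iff.1 H.base_mem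
  exact ⟨z, fun e he => H.base_pos e he z (h ▸ self_mem_chamberAt hz)⟩

/-- All normals are positive on the base chamber, so a factor `⟪e, z⟫` is negative exactly when `e`
separates. -/
theorem sign_chamberAt {z : V} (hz : z ∈ complement H.normals) :
    H.sign (chamberAt H.normals z) = signProd H.normals z := by
  classical
  have hb : H.base.Nonempty := by
    obtain ⟨b, hb, h⟩ := mem_chambers_iff.1 H.base_mem
    exact ⟨b, h ▸ self_mem_chamberAt hb⟩
  have key : ∀ e ∈ H.normals,
      (SignType.sign ⟪e, z⟫ : ℝ) = if OppositeSides e H.base (chamberAt H.normals z)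
        then -1 else 1 := by
    intro e he
    obtain ⟨b, hb⟩ := hb
    rcases lt_or_gt_of_ne (mem_complement_iff.1 hz e he) with h | h
    · rw [if_pos, sign_neg h]
      · simp
      · refine Or.inl ⟨H.base_pos e he, fun y hy => ?_⟩
        have := hy e he
        rwa [mul_pos_iff_neg_of_neg h] at this
    · rw [if_neg, sign_pos h]
      · simp
      · rintro (⟨-, h2⟩ | ⟨h1, -⟩)
        · exact (h2 z (self_mem_chamberAt hz)).not_gt h
        · exact (h1 b hb).not_gt (H.base_pos e he b hb)
  have h1 : signProd H.normals z = ∏ e ∈ H.normals, (SignType.sign ⟪e, z⟫ : ℝ) := by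
    exact map_prod ((SignType.castHom : SignType →*₀ ℝ).comp (signHom : ℝ →*₀ SignType))
      (fun e => ⟪e, z⟫) H.normals
  rw [h1, Finset.prod_congr rfl key, Finset.prod_ite]
  simp only [Finset.prod_const, one_pow, mul_one]
  unfold sign separationSet
  congr

/-- Chambers are disjoint and cover the complement, so at most one term survives. This is the
pointwise form of the passage from sums to integrals. -/
theorem sum_sign_indicator (x : V) :
    ∑ T ∈ H.chamberFinset, H.sign T * T.indicator 1 x = signProd H.normals x := by
  by_cases hx : x ∈ complement H.normals
  · rw [Finset.sum_eq_single (chamberAt H.normals x)]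
    · simp [H.sign_chamberAt hx, self_mem_chamberAt hx]
    · intro T hT hne
      obtain ⟨z, hz, rfl⟩ := H.mem_chamberFinset.1 hT
      rw [Set.indicator_of_notMem, mul_zero]
      exact fun h => hne (chamberAt_eq_of_mem h).symm
    · exact fun h => absurd (H.mem_chamberFinset.2 ⟨x, hx, rfl⟩) h
  · rw [signProd_eq_zero_of_notMem hx]
    refine Finset.sum_eq_zero fun T hT => ?_
    obtain ⟨z, hz, rfl⟩ := H.mem_chamberFinset.1 hT
    rw [Set.indicator_of_notMem, mul_zero]
    exact fun h => hx (chamberAt_subset_complement _ _ h)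

/-- The signs of the two chambers adjacent at a generic point of a hyperplane cancel. -/
theorem sum_sign_indicator_closure {e x : V} (he : e ∈ H.normals) (hex : ⟪e, x⟫ = 0)
    (hx : ∀ f ∈ H.normals, f ≠ e → ⟪f, x⟫ ≠ 0) :
    ∑ T ∈ H.chamberFinset, H.sign T * (closure T).indicator 1 x = 0 := by
  classical
  have hee : (0 : ℝ) < ⟪e, e⟫ := real_inner_self_pos.2 (H.normal_ne_zero he)
  -- A displacement of size `ε` along `e` is too small to cross any hyperplane other than that of
  -- `e`.
  obtain ⟨ε, hε, hεs⟩ : ∃ ε : ℝ, 0 < ε ∧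
      ∀ f ∈ H.normals.erase e, |ε * ⟪f, e⟫| < |⟪f, x⟫| := by
    have : ∀ᶠ ε : ℝ in nhdsWithin 0 (Set.Ioi 0),
        ∀ f ∈ H.normals.erase e, |ε * ⟪f, e⟫| < |⟪f, x⟫| := by
      refine (Finset.eventually_all _).2 fun f hf => ?_
      have hc : Continuous fun ε : ℝ => |ε * ⟪f, e⟫| := by fun_prop
      have h0 : Filter.Tendsto (fun ε : ℝ => |ε * ⟪f, e⟫|) (nhdsWithin 0 (Set.Ioi 0))
          (nhds 0) := by
        simpa using (hc.tendsto 0).mono_left nhdsWithin_le_nhds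
      exact h0.eventually_lt_const (abs_pos.2 (hx f (Finset.mem_of_mem_erase hf)
        (Finset.ne_of_mem_erase hf)))
    obtain ⟨ε, h, hε⟩ := (this.and eventually_mem_nhdsWithin).exists
    exact ⟨ε, hε, h⟩
  have hsame : ∀ s : ℝ, |s| = ε → ∀ f ∈ H.normals.erase e,
      0 < ⟪f, x⟫ * ⟪f, x + s • e⟫ := by
    intro s hs f hf
    have h := hεs f hf
    rw [inner_add_right, inner_smul_right, mul_add]
    have h1 : |s * ⟪f, e⟫| < |⟪f, x⟫| := by
      rw [abs_mul, hs]; rwa [abs_mul, abs_of_pos hε] at h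
    have h2 : |⟪f, x⟫ * (s * ⟪f, e⟫)| < ⟪f, x⟫ * ⟪f, x⟫ := by
      rw [abs_mul, ← abs_mul_abs_self ⟪f, x⟫]
      exact mul_lt_mul_of_pos_left h1 ((abs_nonneg _).trans_lt h1)
    linarith [(abs_lt.1 h2).1]
  have hpt : ∀ s : ℝ, ⟪e, x + s • e⟫ = s * ⟪e, e⟫ := by
    intro s; rw [inner_add_right, inner_smul_right, hex, zero_add]
  -- Hence a closed chamber contains `x` iff the open chamber contains one of `x ± ε • e`, and then
  -- exactly one of them.
  have hmem : ∀ z ∈ complement H.normals, ∀ s : ℝ, |s| = ε →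
      (x + s • e ∈ chamberAt H.normals z ↔
        x ∈ closure (chamberAt H.normals z) ∧ 0 < ⟪e, z⟫ * s) := by
    intro z hz s hs
    rw [closure_chamberAt hz]
    have hf : ∀ f ∈ H.normals.erase e,
        (0 < ⟪f, z⟫ * ⟪f, x + s • e⟫ ↔ 0 ≤ ⟪f, z⟫ * ⟪f, x⟫) := by
      intro f hf
      have h1 := hsame s hs f hf
      have hzf := mem_complement_iff.1 hz f (Finset.mem_of_mem_erase hf)
      have hxf := left_ne_zero_of_mul h1.ne'
      have hprod : 0 < (⟪f, z⟫ * ⟪f, x⟫) * (⟪f, z⟫ * ⟪f, x + s • e⟫) := by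
        have := mul_pos (mul_self_pos.2 hzf) h1
        linarith
      constructor
      · intro h
        exact ((mul_pos_iff_of_pos_right h).1 hprod).le
      · intro h
        exact (mul_pos_iff_of_pos_left (lt_of_le_of_ne h (mul_ne_zero hzf hxf).symm)).1 hprod
    constructor
    · intro h
      refine ⟨fun f hfE => ?_, ?_⟩
      · by_cases hfe : f = e
        · simp [hfe, hex]
        · exact (hf f (Finset.mem_erase.2 ⟨hfe, hfE⟩)).1 (h f hfE)
      · have := h e he
        rw [hpt, ← mul_assoc] at this
        exact (mul_pos_iff_of_pos_right hee).1 this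
    · rintro ⟨h1, h2⟩ f hfE
      by_cases hfe : f = e
      · rw [hfe, hpt, ← mul_assoc]
        exact mul_pos h2 hee
      · exact (hf f (Finset.mem_erase.2 ⟨hfe, hfE⟩)).2 (h1 f hfE)
  have hind : ∀ T ∈ H.chamberFinset, H.sign T * (closure T).indicator (1 : V → ℝ) x =
      H.sign T * T.indicator 1 (x + ε • e) + H.sign T * T.indicator 1 (x + (-ε) • e) := by
    intro T hT
    obtain ⟨z, hz, rfl⟩ := H.mem_chamberFinset.1 hT
    have h1 := hmem z hz ε (abs_of_pos hε)
    have h2 := hmem z hz (-ε) (by rw [abs_neg, abs_of_pos hε])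
    rw [← mul_add]
    congr 1
    rcases lt_or_gt_of_ne (mem_complement_iff.1 hz e he) with h | h
    · have h3 : ¬ 0 < ⟪e, z⟫ * ε := by nlinarith
      have h4 : 0 < ⟪e, z⟫ * -ε := by nlinarith
      simp only [Set.indicator, h1, h2, h3, h4]
      simp
    · have h3 : 0 < ⟪e, z⟫ * ε := by positivity
      have h4 : ¬ 0 < ⟪e, z⟫ * -ε := by nlinarith
      simp only [Set.indicator, h1, h2, h3, h4]
      simp
  rw [Finset.sum_congr rfl hind, Finset.sum_add_distrib, sum_sign_indicator, sum_sign_indicator]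
  have hneg : SignType.sign (normalProd H.normals (x + (-ε) • e)) =
      -SignType.sign (normalProd H.normals (x + ε • e)) := by
    have hmul : normalProd H.normals (x + (-ε) • e) * normalProd H.normals (x + ε • e) < 0 := by
      unfold normalProd
      rw [← Finset.mul_prod_erase _ _ he, ← Finset.mul_prod_erase _ (fun f => ⟪f, x + ε • e⟫) he,
        hpt, hpt, mul_mul_mul_comm, ← Finset.prod_mul_distrib]
      refine mul_neg_of_neg_of_pos ?_ (Finset.prod_pos fun f hf => ?_)
      · have := mul_pos hε hee
        nlinarith
      · have h1 := hsame ε (abs_of_pos hε) f hf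
        have h2 := hsame (-ε) (by rw [abs_neg, abs_of_pos hε]) f hf
        have h3 := mul_pos h1 h2
        have h4 := mul_self_pos.2 (left_ne_zero_of_mul h1.ne')
        refine (mul_pos_iff_of_pos_left h4).1 ?_
        linarith
    rcases lt_or_gt_of_ne (right_ne_zero_of_mul hmul.ne) with h | h
    · rw [sign_neg h, sign_pos (pos_of_mul_neg_left hmul h.le)]; rfl
    · rw [sign_pos h, sign_neg (neg_of_mul_neg_left hmul h.le)]
  unfold signProd
  rw [hneg]
  simp

end Arrangement

theorem Arrangement.isOpen_of_mem_chamberFinset (H : Arrangement V) {T : Set V}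
    (hT : T ∈ H.chamberFinset) : IsOpen T := by
  obtain ⟨z, -, rfl⟩ := H.mem_chamberFinset.1 hT
  exact isOpen_chamberAt _ _

variable [MeasurableSpace V] [BorelSpace V]

theorem measurable_sign_real : Measurable (fun t : ℝ => (SignType.sign t : ℝ)) := by
  have : (fun t : ℝ => (SignType.sign t : ℝ)) = fun t => if 0 < t then 1 else if t < 0 then -1
      else 0 := by
    ext t
    rw [sign_apply]
    split_ifs <;> simp
  rw [this]
  exact Measurable.ite measurableSet_Ioi measurable_const
    (Measurable.ite measurableSet_Iio measurable_const measurable_const)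

theorem measurable_signProd (E : Finset V) : Measurable (signProd E) :=
  measurable_sign_real.comp (continuous_normalProd E).measurable

namespace Arrangement

variable (H : Arrangement V)

/-- The map `g` serves two cases: the identity for volumes of balls, and the parametrization of a
sphere by unit directions. -/
theorem sum_sign_mul_measureReal {α : Type*} [MeasurableSpace α] (μ : Measure α)
    [IsFiniteMeasure μ] {g : α → V} (hg : Measurable g) :
    ∑ T ∈ H.chamberFinset, H.sign T * μ.real (g ⁻¹' T) = ∫ x, signProd H.normals (g x) ∂μ := by
  have hm : ∀ T ∈ H.chamberFinset, MeasurableSet (g ⁻¹' T) := fun T hT =>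
    hg (H.isOpen_of_mem_chamberFinset hT).measurableSet
  simp_rw [← H.sum_sign_indicator]
  rw [integral_finsetSum]
  · refine Finset.sum_congr rfl fun T hT => ?_
    rw [integral_const_mul]
    congr 1
    rw [← integral_indicator_one (hm T hT)]
    rfl
  · intro T hT
    refine Integrable.const_mul ?_ _
    have : Integrable ((g ⁻¹' T).indicator (1 : α → ℝ)) μ :=
      (integrable_const (1 : ℝ)).indicator (hm T hT)
    exact this

theorem pizzaQuantity_eq_integral [FiniteDimensional ℝ V] {K : Set V} (hK : volume K ≠ ⊤) :
    H.pizzaQuantity K = ∫ x in K, signProd H.normals x := by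
  have : IsFiniteMeasure (volume.restrict K) := ⟨by simpa using hK.lt_top⟩
  have h := H.sum_sign_mul_measureReal (volume.restrict K) measurable_id
  simp only [id_eq] at h
  rw [← h, pizzaQuantity]
  refine Finset.sum_congr rfl fun T hT => ?_
  rw [Set.preimage_id, measureReal_restrict_apply (H.isOpen_of_mem_chamberFinset hT).measurableSet,
    Set.inter_comm]

end Arrangement

end Chambers

/-! ### Uniqueness of uniformly distributed measures on a metric space. -/

section UniformMeasures

open Filter Topology ENNReal

variable {X : Type*} [MetricSpace X] [SecondCountableTopology X] [MeasurableSpace X]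

/-- One null ball makes all balls of that radius null, and a locally null measure is zero in a
second countable space. -/
theorem measure_ball_ne_zero_of_uniform {μ : Measure X} (h0 : μ ≠ 0)
    (h : ∀ x y r, μ (Metric.ball x r) = μ (Metric.ball y r)) (x : X) {r : ℝ} (hr : 0 < r) :
    μ (Metric.ball x r) ≠ 0 := by
  intro hx
  refine h0 (Measure.measure_univ_eq_zero.1 (measure_null_of_locally_null _ fun y _ => ?_))
  exact ⟨Metric.ball y r, mem_nhdsWithin_of_mem_nhds (Metric.ball_mem_nhds y hr),
    (h y x r).trans hx⟩

variable [BorelSpace X]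

/-- The quotients `ν(U ∩ B(x, r)) / ν(B(x, r))` tend to 1 at each point of `U`. Fatou bounds `μ U`
by the lower limit of their integrals over `U`, and Tonelli exchanges the roles of `μ` and `ν` in
those integrals. -/
theorem measure_open_le_liminf_of_uniform {μ ν : Measure X} [IsFiniteMeasure μ] [IsFiniteMeasure ν]
    (hν0 : ν ≠ 0) (hμ : ∀ x y r, μ (Metric.ball x r) = μ (Metric.ball y r))
    (hν : ∀ x y r, ν (Metric.ball x r) = ν (Metric.ball y r)) (x₀ : X)
    {r : ℕ → ℝ} (hr : ∀ j, 0 < r j) (hr0 : Tendsto r atTop (𝓝 0)) {U : Set X} (hU : IsOpen U) :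
    μ U ≤ liminf (fun j => μ (Metric.ball x₀ (r j)) / ν (Metric.ball x₀ (r j))) atTop * ν U := by
  have hD : ∀ ρ : ℝ, MeasurableSet {p : X × X | dist p.1 p.2 < ρ} := fun ρ =>
    (isOpen_lt continuous_dist continuous_const).measurableSet
  have hfib : ∀ (ρ : ℝ) (x : X), Prod.mk x ⁻¹' {p : X × X | dist p.1 p.2 < ρ} = Metric.ball x ρ := by
    intro ρ x; ext y; simp [dist_comm]
  have hfib' : ∀ (ρ : ℝ) (y : X), (fun x => (x, y)) ⁻¹' {p : X × X | dist p.1 p.2 < ρ} =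
      Metric.ball y ρ := by
    intro ρ y; ext x; simp
  set φ : ℕ → X → ℝ≥0∞ := fun j x =>
    ν.restrict U (Metric.ball x (r j)) / ν (Metric.ball x₀ (r j)) with hφ
  have hmeas : ∀ j, Measurable fun x => ν.restrict U (Metric.ball x (r j)) := by
    intro j
    have := measurable_measure_prodMk_left (ν := ν.restrict U) (hD (r j))
    simpa only [hfib] using this
  have hlim : ∀ x ∈ U, liminf (fun j => φ j x) atTop = 1 := by
    intro x hx
    obtain ⟨ε, hε, hball⟩ := Metric.isOpen_iff.1 hU x hx
    refine (tendsto_const_nhds.congr' ?_).liminf_eq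
    filter_upwards [hr0.eventually_lt_const hε] with j hj
    have hsub : Metric.ball x (r j) ⊆ U := (Metric.ball_subset_ball hj.le).trans hball
    rw [hφ]
    simp only
    rw [Measure.restrict_apply Metric.isOpen_ball.measurableSet, Set.inter_eq_left.2 hsub,
      hν x x₀, ENNReal.div_self (measure_ball_ne_zero_of_uniform hν0 hν x₀ (hr j))
        (measure_ne_top _ _)]
  have hswap : ∀ j, ∫⁻ x in U, φ j x ∂μ ≤
      μ (Metric.ball x₀ (r j)) / ν (Metric.ball x₀ (r j)) * ν U := by
    intro j
    have h1 : ∫⁻ x in U, ν.restrict U (Metric.ball x (r j)) ∂μ =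
        ∫⁻ y in U, μ.restrict U (Metric.ball y (r j)) ∂ν := by
      have h2 := Measure.prod_apply (μ := μ.restrict U) (ν := ν.restrict U) (hD (r j))
      have h3 := Measure.prod_apply_symm (μ := μ.restrict U) (ν := ν.restrict U) (hD (r j))
      simp only [hfib, hfib'] at h2 h3
      exact h2.symm.trans h3
    simp only [hφ, div_eq_mul_inv]
    rw [lintegral_mul_const _ (hmeas j), h1, mul_right_comm]
    gcongr
    calc ∫⁻ y in U, μ.restrict U (Metric.ball y (r j)) ∂ν
        ≤ ∫⁻ _ in U, μ (Metric.ball x₀ (r j)) ∂ν := by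
          refine lintegral_mono fun y => ?_
          rw [hμ x₀ y]
          exact Measure.restrict_apply_le _ _
      _ = μ (Metric.ball x₀ (r j)) * ν U := by simp
  calc μ U = ∫⁻ x in U, liminf (fun j => φ j x) atTop ∂μ := by
        rw [setLIntegral_congr_fun hU.measurableSet hlim]; simp
    _ ≤ liminf (fun j => ∫⁻ x in U, φ j x ∂μ) atTop :=
        lintegral_liminf_le fun j => (hmeas j).div_const _
    _ ≤ liminf (fun j => μ (Metric.ball x₀ (r j)) / ν (Metric.ball x₀ (r j)) * ν U) atTop :=
        liminf_le_liminf (Eventually.of_forall hswap)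
    _ = _ := by
        refine (Monotone.map_liminf_of_continuousAt (f := fun t : ℝ≥0∞ => t * ν U)
          (fun a b h => by dsimp; gcongr) _ ?_).symm
        exact (ENNReal.continuous_mul_const (measure_ne_top _ _)).continuousAt

/-- Two nonzero finite measures for which the measure of a ball depends only on its radius are
proportional. -/
theorem exists_eq_smul_of_uniform {μ ν : Measure X} [IsFiniteMeasure μ] [IsFiniteMeasure ν]
    (hμ0 : μ ≠ 0) (hν0 : ν ≠ 0) (hμ : ∀ x y r, μ (Metric.ball x r) = μ (Metric.ball y r))
    (hν : ∀ x y r, ν (Metric.ball x r) = ν (Metric.ball y r)) :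
    ∃ c : ℝ≥0∞, c ≠ 0 ∧ c ≠ ⊤ ∧ μ = c • ν := by
  have hX : Nonempty X := by
    by_contra h
    rw [not_nonempty_iff] at h
    exact hμ0 (Measure.eq_zero_of_isEmpty μ)
  obtain ⟨x₀⟩ := hX
  obtain ⟨r, -, hr, hr0⟩ := exists_seq_strictAnti_tendsto (0 : ℝ)
  have h1 := fun U (hU : IsOpen U) =>
    measure_open_le_liminf_of_uniform hν0 hμ hν x₀ hr hr0 hU
  have h2 := fun U (hU : IsOpen U) =>
    measure_open_le_liminf_of_uniform hμ0 hν hμ x₀ hr hr0 hU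
  set c := liminf (fun j => μ (Metric.ball x₀ (r j)) / ν (Metric.ball x₀ (r j))) atTop
  set d := liminf (fun j => ν (Metric.ball x₀ (r j)) / μ (Metric.ball x₀ (r j))) atTop
  -- The two sequences of ratios are reciprocal, and the product of the lower limits is at most the
  -- lower limit of the product. This closes the chain `μ U ≤ c * ν U ≤ c * d * μ U ≤ μ U`.
  have hcd : c * d ≤ 1 := by
    refine ENNReal.le_liminf_mul.trans ?_
    refine (liminf_congr (v := fun _ => (1 : ℝ≥0∞)) (Eventually.of_forall fun j => ?_)).trans_le
      (by simp)
    have ha := measure_ball_ne_zero_of_uniform hμ0 hμ x₀ (hr j)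
    have hb := measure_ball_ne_zero_of_uniform hν0 hν x₀ (hr j)
    simp only [Pi.mul_apply]
    rw [← ENNReal.inv_div (Or.inl (measure_ne_top _ _)) (Or.inl ha)]
    exact ENNReal.inv_mul_cancel (by simp [hb, measure_ne_top])
      (by simp [ENNReal.div_eq_top, ha, measure_ne_top])
  have hc0 : c ≠ 0 := by
    intro h
    have := h1 Set.univ isOpen_univ
    rw [h, zero_mul, nonpos_iff_eq_zero] at this
    exact hμ0 (Measure.measure_univ_eq_zero.1 this)
  have hd0 : d ≠ 0 := by
    intro h
    have := h2 Set.univ isOpen_univ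
    rw [h, zero_mul, nonpos_iff_eq_zero] at this
    exact hν0 (Measure.measure_univ_eq_zero.1 this)
  have hct : c ≠ ⊤ := by
    intro h
    rw [h, ENNReal.top_mul hd0] at hcd
    simp at hcd
  refine ⟨c, hc0, hct, ?_⟩
  have hfin : IsFiniteMeasure (c • ν) := Measure.smul_finite ν hct
  refine Measure.OuterRegular.ext_isOpen fun U hU => le_antisymm (h1 U hU) ?_
  calc c * ν U ≤ c * (d * μ U) := by gcongr; exact h2 U hU
    _ = c * d * μ U := (mul_assoc _ _ _).symm
    _ ≤ 1 * μ U := by gcongr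
    _ = μ U := one_mul _

end UniformMeasures

/-! ### Hausdorff measure on spheres and hyperplanes, and polar coordinates. -/

section SphereMeasure

open Metric
open scoped Pointwise

variable {V : Type*} [NormedAddCommGroup V] [InnerProductSpace ℝ V]

/-- The isometry of the unit sphere induced by a linear isometry. -/
def sphereIsometry (w : V ≃ₗᵢ[ℝ] V) : sphere (0 : V) 1 ≃ᵢ sphere (0 : V) 1 where
  toFun u := ⟨w u, by simp⟩
  invFun u := ⟨w.symm u, by simp⟩
  left_inv u := by simp
  right_inv u := by simp
  isometry_toFun u v := by simp [Subtype.edist_eq]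

@[simp]
theorem coe_sphereIsometry (w : V ≃ₗᵢ[ℝ] V) (u : sphere (0 : V) 1) :
    (sphereIsometry w u : V) = w u := rfl

/-- Transitivity on the sphere makes an invariant measure assign equal mass to balls of equal
radius. -/
theorem exists_sphereIsometry_eq (x y : sphere (0 : V) 1) :
    ∃ w : V ≃ₗᵢ[ℝ] V, sphereIsometry w x = y :=
  ⟨(ℝ ∙ (x - y : V))ᗮ.reflection, Subtype.ext (Submodule.reflection_sub (by simp))⟩

theorem measure_ball_eq_of_invariant [MeasurableSpace V] [BorelSpace V]
    {μ : Measure (sphere (0 : V) 1)}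
    (hμ : ∀ w : V ≃ₗᵢ[ℝ] V, MeasurePreserving (sphereIsometry w) μ μ)
    (x y : sphere (0 : V) 1) (r : ℝ) : μ (ball x r) = μ (ball y r) := by
  obtain ⟨w, rfl⟩ := exists_sphereIsometry_eq x y
  rw [← (hμ w).measure_preimage isOpen_ball.measurableSet.nullMeasurableSet (s := ball (sphereIsometry w x) r),
    (sphereIsometry w).preimage_ball, IsometryEquiv.symm_apply_apply]

variable [FiniteDimensional ℝ V]

theorem finrank_hyperplane {e : V} (he : e ≠ 0) :
    finrank ℝ (hyperplane e) = finrank ℝ V - 1 := by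
  have h := (ℝ ∙ e).finrank_add_finrank_orthogonal
  rw [finrank_span_singleton he] at h
  unfold hyperplane
  omega

variable [MeasurableSpace V] [BorelSpace V]

/-- `toSphere` measures the cone over a set, and a linear isometry carries cones to cones of the
same volume. -/
theorem measurePreserving_toSphere (w : V ≃ₗᵢ[ℝ] V) :
    MeasurePreserving (sphereIsometry w) (volume : Measure V).toSphere
      (volume : Measure V).toSphere := by
  refine ⟨(sphereIsometry w).continuous.measurable, Measure.ext fun s hs => ?_⟩
  have hm := (sphereIsometry w).continuous.measurable
  rw [Measure.map_apply hm hs, Measure.toSphere_apply' _ hs, Measure.toSphere_apply' _ (hm hs)]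
  congr 1
  rw [← (show MeasurePreserving w.toMeasurableEquiv volume volume from
    w.measurePreserving).measure_preimage_equiv
      (Set.Ioo (0 : ℝ) 1 • (((↑) : sphere (0 : V) 1 → V) '' s) : Set V)]
  congr 1
  ext x
  simp only [Set.mem_smul, Set.mem_preimage, Set.mem_image]
  constructor
  · rintro ⟨t, ht, _, ⟨u, hu, rfl⟩, rfl⟩
    exact ⟨t, ht, _, ⟨_, hu, rfl⟩, by simp⟩
  · rintro ⟨t, ht, _, ⟨u, hu, rfl⟩, hx⟩
    refine ⟨t, ht, _, ⟨(sphereIsometry w).symm u, by simpa using hu, rfl⟩, w.injective ?_⟩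
    rw [map_smul, ← coe_sphereIsometry, IsometryEquiv.apply_symm_apply]
    exact hx

/-- The Hausdorff measure of a subset of a subspace is its volume in this subspace. -/
theorem euclideanHausdorffMeasure_eq_volume_preimage (K : Submodule ℝ V) {d : ℕ}
    (hd : finrank ℝ K = d) {s : Set V} (hs : s ⊆ K) :
    μHE[d] s = volume ((↑) ⁻¹' s : Set K) := by
  subst hd
  rw [← InnerProductSpace.euclideanHausdorffMeasure_eq_volume,
    (show Isometry ((↑) : K → V) from isometry_subtype_coe).euclideanHausdorffMeasure_preimage,
    Subtype.range_coe, Set.inter_eq_left.2 hs]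

theorem euclideanHausdorffMeasure_hyperplane_inter_hyperplane {e f : V} (he : ‖e‖ = 1)
    (hf : ‖f‖ = 1) (h1 : f ≠ e) (h2 : f ≠ -e) :
    μHE[finrank ℝ V - 1] (hyperplane e ∩ hyperplane f : Set V) = 0 := by
  have he0 : e ≠ 0 := by rintro rfl; simp at he
  rw [euclideanHausdorffMeasure_eq_volume_preimage _ (finrank_hyperplane he0)
    Set.inter_subset_left]
  have : ((↑) ⁻¹' (hyperplane e ∩ hyperplane f : Set V) : Set (hyperplane e)) =
      ((hyperplane f).comap (hyperplane e).subtype : Set (hyperplane e)) := by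
    ext x; simp
  rw [this]
  refine Measure.addHaar_submodule _ _ fun htop => ?_
  have hle : hyperplane e ≤ hyperplane f := by
    rw [Submodule.comap_subtype_eq_top] at htop
    exact htop
  rw [hyperplane, hyperplane, Submodule.orthogonal_le_orthogonal_iff,
    Submodule.span_singleton_le_iff_mem, Submodule.mem_span_singleton] at hle
  obtain ⟨c, rfl⟩ := hle
  rw [norm_smul, he, mul_one, Real.norm_eq_abs] at hf
  rcases (abs_eq zero_le_one).1 hf with rfl | rfl
  · simp at h1
  · simp at h2

theorem euclideanHausdorffMeasure_closedBall_inter_hyperplane_lt_top {e : V} (he : e ≠ 0)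
    (a : V) (R : ℝ) : μHE[finrank ℝ V - 1] (closedBall a R ∩ hyperplane e : Set V) < ⊤ := by
  rw [euclideanHausdorffMeasure_eq_volume_preimage _ (finrank_hyperplane he)
    Set.inter_subset_right]
  refine (measure_mono (t := closedBall 0 (R + ‖a‖)) fun x hx => ?_).trans_lt
    measure_closedBall_lt_top
  have h : ‖(x : V) - a‖ ≤ R := by simpa [dist_eq_norm] using hx
  rw [mem_closedBall_zero_iff, Submodule.coe_norm]
  linarith [norm_le_norm_sub_add (x : V) a]

/-- By Pythagoras the intersection lies in a sphere of the hyperplane centred at the projection `p`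
of `a`. Such a sphere is null if the hyperplane has positive dimension, even for radius 0
(tangency), or if its radius is nonzero. -/
theorem euclideanHausdorffMeasure_sphere_inter_hyperplane {e : V} (he : e ≠ 0) {a : V} {R : ℝ}
    (hR : 0 < R) (h : 2 ≤ finrank ℝ V ∨ ‖a‖ < R) :
    μHE[finrank ℝ V - 1] (sphere a R ∩ hyperplane e : Set V) = 0 := by
  rw [euclideanHausdorffMeasure_eq_volume_preimage _ (finrank_hyperplane he)
    Set.inter_subset_right]
  set p : hyperplane e := (hyperplane e).orthogonalProjectionOnto a
  have hpy : ∀ x : hyperplane e, ‖(x : V) - a‖ ^ 2 = ‖x - p‖ ^ 2 + ‖(p : V) - a‖ ^ 2 := by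
    intro x
    have horth : ⟪((x - p : hyperplane e) : V), (p : V) - a⟫ = 0 := by
      rw [← neg_sub a, inner_neg_right,
        Submodule.inner_right_of_mem_orthogonal (v := a - p) (x - p).2
          ((hyperplane e).sub_starProjection_mem_orthogonal a), neg_zero]
    have := norm_add_sq_eq_norm_sq_add_norm_sq_of_inner_eq_zero _ _ horth
    simp only [← sq] at this
    rw [Submodule.coe_norm, ← this]
    simp
  have hsub : ((↑) ⁻¹' (sphere a R ∩ hyperplane e : Set V) : Set (hyperplane e)) ⊆
      sphere p (√(R ^ 2 - ‖(p : V) - a‖ ^ 2)) := by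
    intro x hx
    have h1 : ‖(x : V) - a‖ = R := by simpa [dist_eq_norm] using hx
    rw [mem_sphere, dist_eq_norm, ← h1, hpy x, add_sub_cancel_right, Real.sqrt_sq (norm_nonneg _)]
  refine measure_mono_null hsub ?_
  rcases h with h | h
  · have : Nontrivial (hyperplane e) := by
      refine Module.nontrivial_of_finrank_pos (R := ℝ) ?_
      rw [finrank_hyperplane he]
      omega
    exact Measure.addHaar_sphere _ _ _
  · refine Measure.addHaar_sphere_of_ne_zero _ _ (Real.sqrt_pos.2 ?_).ne'
    -- Pythagoras at the origin gives `‖p - a‖ ≤ ‖a‖ < R`, so the radius is positive.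
    have h0 := hpy 0
    simp only [Submodule.coe_zero, zero_sub, norm_neg] at h0
    nlinarith [norm_nonneg a, sq_nonneg ‖p‖]

/-- Two opposite closed hemispheres cover the sphere, and each lies in a Lipschitz image, under
inverse stereographic projection, of a bounded piece of a hyperplane. -/
theorem euclideanHausdorffMeasure_unitSphere_lt_top :
    μHE[finrank ℝ V - 1] (sphere (0 : V) 1) < ⊤ := by
  rcases subsingleton_or_nontrivial V with hV | hV
  · have : sphere (0 : V) 1 = ∅ := by
      ext x; simp [Subsingleton.elim x 0]
    simp [this]
  obtain ⟨v, hv⟩ := exists_norm_eq V zero_le_one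
  have key : ∀ v : V, ‖v‖ = 1 → μHE[finrank ℝ V - 1] (sphere (0 : V) 1 ∩ {x | ⟪v, x⟫ ≤ 0}) < ⊤ := by
    intro v hv
    have hv0 : v ≠ 0 := by rintro rfl; simp at hv
    set A : Set V := closedBall (0 : V) 2 ∩ hyperplane v
    obtain ⟨K, hK⟩ := (contDiff_stereoInvFunAux (v := v)
      (m := 1)).contDiffOn.exists_lipschitzOnWith one_ne_zero
        (convex_closedBall (0 : V) 2) (isCompact_closedBall (0 : V) 2)
    have hsub : sphere (0 : V) 1 ∩ {x | ⟪v, x⟫ ≤ 0} ⊆ stereoInvFunAux v '' A := by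
      rintro x ⟨hx, hvx : ⟪v, x⟫ ≤ 0⟩
      have hxv : x ≠ v := by
        rintro rfl
        rw [real_inner_self_eq_norm_sq, hv] at hvx
        norm_num at hvx
      refine ⟨stereoToFun v x, ⟨?_, (stereoToFun v x).2⟩, ?_⟩
      · rw [mem_closedBall_zero_iff, ← Submodule.coe_norm, stereoToFun_apply, norm_smul]
        have h1 : ‖(ℝ ∙ v)ᗮ.orthogonalProjectionOnto x‖ ≤ 1 := by
          refine (Submodule.norm_orthogonalProjectionOnto_apply_le _ _).trans ?_
          simpa using hx.le
        -- On the hemisphere away from the pole `v` the denominator is at least 1, whence the radius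
        -- 2 in `A`.
        have h2 : ‖(2 : ℝ) / (1 - innerSL ℝ v x)‖ ≤ 2 := by
          rw [innerSL_apply_apply, Real.norm_eq_abs, abs_of_pos (by apply div_pos <;> linarith)]
          rw [div_le_iff₀ (by linarith)]
          linarith
        nlinarith [norm_nonneg ((ℝ ∙ v)ᗮ.orthogonalProjectionOnto x)]
      · exact congrArg Subtype.val (stereo_left_inv hv (x := ⟨x, hx⟩) hxv)
    refine (measure_mono hsub).trans_lt ?_
    have hA := euclideanHausdorffMeasure_closedBall_inter_hyperplane_lt_top hv0 0 2
    have hL := (hK.mono (Set.inter_subset_left (t := (hyperplane v : Set V)))).hausdorffMeasure_image_le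
      (d := ((finrank ℝ V - 1 : ℕ) : ℝ)) (by positivity)
    rw [Measure.euclideanHausdorffMeasure_def, Measure.smul_apply] at hA ⊢
    set c := (volume : Measure (EuclideanSpace ℝ (Fin (finrank ℝ V - 1)))).addHaarScalarFactor
      μH[((finrank ℝ V - 1 : ℕ) : ℝ)]
    rw [ENNReal.smul_def, smul_eq_mul] at hA ⊢
    refine (mul_le_mul_right hL _).trans_lt ?_
    rw [mul_left_comm]
    exact ENNReal.mul_lt_top (ENNReal.rpow_lt_top_of_nonneg (by positivity) (by simp)) hA
  have hcov : sphere (0 : V) 1 ⊆ (sphere (0 : V) 1 ∩ {x | ⟪v, x⟫ ≤ 0}) ∪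
      (sphere (0 : V) 1 ∩ {x | ⟪-v, x⟫ ≤ 0}) := by
    intro x hx
    rcases le_total ⟪v, x⟫ 0 with h | h
    · exact Or.inl ⟨hx, h⟩
    · exact Or.inr ⟨hx, by simpa using h⟩
  exact (measure_mono hcov).trans_lt ((measure_union_le _ _).trans_lt
    (ENNReal.add_lt_top.2 ⟨key v hv, key (-v) (by simpa using hv)⟩))

instance isFiniteMeasure_euclideanHausdorffMeasure_unitSphere :
    IsFiniteMeasure (μHE[finrank ℝ V - 1] : Measure (sphere (0 : V) 1)) := by
  refine ⟨?_⟩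
  rw [← (show Isometry ((↑) : sphere (0 : V) 1 → V) from
    isometry_subtype_coe).euclideanHausdorffMeasure_image]
  rw [Set.image_univ, Subtype.range_coe]
  exact euclideanHausdorffMeasure_unitSphere_lt_top

/-- The Hausdorff measure of the unit sphere is proportional to the measure of polar coordinates. -/
theorem toSphere_eq_smul_euclideanHausdorffMeasure [Nontrivial V]
    (h0 : (μHE[finrank ℝ V - 1] : Measure (sphere (0 : V) 1)) ≠ 0) :
    ∃ c : ENNReal, c ≠ 0 ∧ c ≠ ⊤ ∧
      (volume : Measure V).toSphere = c • (μHE[finrank ℝ V - 1] : Measure (sphere (0 : V) 1)) :=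
  exists_eq_smul_of_uniform (Measure.toSphere_ne_zero _) h0
    (measure_ball_eq_of_invariant measurePreserving_toSphere)
    (measure_ball_eq_of_invariant fun w =>
      (sphereIsometry w).measurePreserving_euclideanHausdorffMeasure _)

theorem integral_volumeIoiPow (k : ℕ) (g : ℝ → ℝ) :
    ∫ r : Set.Ioi (0 : ℝ), g r ∂(Measure.volumeIoiPow k) = ∫ r in Set.Ioi (0 : ℝ), r ^ k * g r := by
  simp only [Measure.volumeIoiPow, ENNReal.ofReal]
  rw [integral_withDensity_eq_integral_smul,
    integral_subtype_comap measurableSet_Ioi fun a => Real.toNNReal (a ^ k) • g a,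
    setIntegral_congr_fun measurableSet_Ioi fun x hx => ?_]
  · rw [NNReal.smul_def, Real.coe_toNNReal _ (pow_nonneg (Set.mem_Ioi.1 hx).le _), smul_eq_mul]
  · exact (measurable_subtype_coe.pow_const _).real_toNNReal

theorem integrable_polar {F : V → ℝ} (hF : Integrable F) :
    Integrable (fun p : sphere (0 : V) 1 × Set.Ioi (0 : ℝ) => F ((p.2 : ℝ) • (p.1 : V)))
      ((volume : Measure V).toSphere.prod (Measure.volumeIoiPow (finrank ℝ V - 1))) := by
  rw [← (volume : Measure V).measurePreserving_homeomorphUnitSphereProd.integrable_comp_emb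
    (Homeomorph.measurableEmbedding _)]
  have h := (integrableOn_iff_comap_subtypeVal (measurableSet_singleton (0 : V)).compl).1
    hF.integrableOn
  refine h.congr (Filter.Eventually.of_forall fun x => ?_)
  have hx : ‖(x : V)‖ ≠ 0 := norm_ne_zero_iff.2 x.2
  simp [smul_smul, hx]

theorem integral_polar [Nontrivial V] (F : V → ℝ) :
    ∫ x, F x = ∫ p : sphere (0 : V) 1 × Set.Ioi (0 : ℝ), F ((p.2 : ℝ) • (p.1 : V))
      ∂((volume : Measure V).toSphere.prod (Measure.volumeIoiPow (finrank ℝ V - 1))) := by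
  rw [← (volume : Measure V).measurePreserving_homeomorphUnitSphereProd.integral_comp
    (Homeomorph.measurableEmbedding _)
    (fun p : sphere (0 : V) 1 × Set.Ioi (0 : ℝ) => F ((p.2 : ℝ) • (p.1 : V)))]
  conv_lhs => rw [← restrict_compl_singleton (μ := (volume : Measure V)) 0,
    ← integral_subtype_comap (measurableSet_singleton _).compl]
  refine integral_congr_ae (Filter.Eventually.of_forall fun x => ?_)
  have hx : ‖(x : V)‖ ≠ 0 := norm_ne_zero_iff.2 x.2
  simp [smul_smul, hx]

end SphereMeasure

/-! ### Behaviour of the sign under negation, scaling and reflections. -/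

section Reflections

variable {V : Type*} [NormedAddCommGroup V] [InnerProductSpace ℝ V]

theorem signProd_neg (E : Finset V) (x : V) :
    signProd E (-x) = (-1) ^ E.card * signProd E x := by
  have : normalProd E (-x) = (-1) ^ E.card * normalProd E x := by
    simp [normalProd, Finset.prod_neg]
  rw [signProd, signProd, this]
  rcases neg_one_pow_eq_or ℝ E.card with h | h <;> simp [h, Left.sign_neg]

theorem signProd_smul (E : Finset V) {r : ℝ} (hr : 0 < r) (x : V) :
    signProd E (r • x) = signProd E x := by
  have : normalProd E (r • x) = r ^ E.card * normalProd E x := by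
    simp [normalProd, inner_smul_right, Finset.prod_mul_distrib]
  rw [signProd, signProd, this, sign_mul, sign_pos (pow_pos hr _), one_mul]

theorem Preserves.map_mem_or_neg_mem {H : Arrangement V} {w : V ≃ₗᵢ[ℝ] V}
    (hw : Preserves w H.normals) {f : V} (hf : f ∈ H.normals) :
    w f ∈ H.normals ∨ -w f ∈ H.normals := by
  obtain ⟨g, hg, h⟩ := hw (hyperplane f) ⟨f, hf, rfl⟩
  have hle : hyperplane g ≤ hyperplane (w f) := by
    rw [h]
    rintro _ ⟨x, hx, rfl⟩
    rw [mem_hyperplane_iff]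
    simpa using (mem_hyperplane_iff f x).1 hx
  rw [hyperplane, hyperplane, Submodule.orthogonal_le_orthogonal_iff,
    Submodule.span_singleton_le_iff_mem, Submodule.mem_span_singleton] at hle
  obtain ⟨c, hc⟩ := hle
  have hn := congrArg norm hc
  rw [norm_smul, H.norm_eq_one g hg, w.norm_map, H.norm_eq_one f hf, mul_one,
    Real.norm_eq_abs] at hn
  rcases (abs_eq zero_le_one).1 hn with rfl | rfl
  · left
    rwa [← hc, one_smul]
  · right
    rwa [← hc, neg_one_smul, neg_neg]

variable [FiniteDimensional ℝ V]

theorem inner_reflection_left (e x y : V) :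
    ⟪(hyperplane e).reflection x, y⟫ = ⟪x, (hyperplane e).reflection y⟫ := by
  rw [← (hyperplane e).reflection.inner_map_map x, Submodule.reflection_reflection]

theorem reflection_self (e : V) : (hyperplane e).reflection e = -e :=
  Submodule.reflection_orthogonalComplement_singleton_eq_neg e

/-- The reflection permutes the normals up to signs: `w f = η f • σ f` with `σ` an involution. The
normal `e` contributes `-1` and all other signs cancel. -/
theorem normalProd_reflection {H : Arrangement V} {e : V} (he : e ∈ H.normals)
    (hw : Preserves (hyperplane e).reflection H.normals) (x : V) :
    normalProd H.normals ((hyperplane e).reflection x) = -normalProd H.normals x := by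
  classical
  set w := (hyperplane e).reflection with hwdef
  have hww : ∀ y, w (w y) = y := Submodule.reflection_reflection _
  set σ : V → V := fun f => if w f ∈ H.normals then w f else -w f with hσ
  set η : V → ℝ := fun f => if w f ∈ H.normals then 1 else -1 with hη
  have hσmem : ∀ f ∈ H.normals, σ f ∈ H.normals := by
    intro f hf
    simp only [hσ]
    split_ifs with h
    · exact h
    · exact (hw.map_mem_or_neg_mem hf).resolve_left h
  have hση : ∀ f ∈ H.normals, σ (σ f) = f ∧ η f * η (σ f) = 1 := by
    intro f hf
    by_cases h : w f ∈ H.normals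
    · simp [hσ, hη, h, hww, hf]
    · simp [hσ, hη, h, hww, H.neg_notMem f hf]
  have hinner : ∀ f, ⟪f, w x⟫ = η f * ⟪σ f, x⟫ := by
    intro f
    rw [← inner_reflection_left]
    by_cases h : w f ∈ H.normals <;> simp [hσ, hη, h, ← hwdef]
  have hwe : w e = -e := reflection_self e
  have hηe : η e = -1 := by simp [hη, hwe, H.neg_notMem e he]
  have hσe : σ e = e := by simp [hσ, hwe, H.neg_notMem e he]
  have hperm : ∏ f ∈ H.normals, ⟪σ f, x⟫ = ∏ f ∈ H.normals, ⟪f, x⟫ :=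
    Finset.prod_nbij' σ σ hσmem hσmem (fun f hf => (hση f hf).1) (fun f hf => (hση f hf).1)
      fun f hf => rfl
  -- Signs cancel along the pairs `f`, `σ f`. A fixed point with sign `-1` would satisfy `w f = -f`,
  -- making `f` a multiple of `e`.
  have hprod : ∏ f ∈ H.normals.erase e, η f = 1 := by
    refine Finset.prod_involution (fun f _ => σ f) ?_ ?_ ?_ ?_
    · exact fun f hf => (hση f (Finset.mem_of_mem_erase hf)).2
    · intro f hf hne hfix
      have h : w f ∉ H.normals := fun h => hne (by simp [hη, h])
      have hfix' : w f = -f := by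
        simp only [hσ, if_neg h] at hfix
        rw [← hfix, neg_neg, hfix]
      have hmem : f ∈ (hyperplane e)ᗮ := by
        intro y hy
        have h1 : ⟪w f, y⟫ = ⟪f, y⟫ := by
          rw [inner_reflection_left, Submodule.reflection_mem_subspace_eq_self hy]
        rw [hfix', inner_neg_left] at h1
        rw [real_inner_comm]
        linarith
      rw [hyperplane, Submodule.orthogonal_orthogonal, Submodule.mem_span_singleton] at hmem
      obtain ⟨c, rfl⟩ := hmem
      have hfE := Finset.mem_of_mem_erase hf
      have hn := H.norm_eq_one _ hfE
      rw [norm_smul, H.norm_eq_one e he, mul_one, Real.norm_eq_abs] at hn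
      rcases (abs_eq zero_le_one).1 hn with rfl | rfl
      · simp at hf
      · exact H.neg_notMem e he (by simpa using hfE)
    · intro f hf
      refine Finset.mem_erase.2 ⟨fun h => Finset.ne_of_mem_erase hf ?_,
        hσmem f (Finset.mem_of_mem_erase hf)⟩
      rw [← (hση f (Finset.mem_of_mem_erase hf)).1, h, hσe]
    · exact fun f hf => (hση f (Finset.mem_of_mem_erase hf)).1
  unfold normalProd
  rw [Finset.prod_congr rfl fun f _ => hinner f, Finset.prod_mul_distrib, hperm,
    ← Finset.mul_prod_erase _ _ he, hprod, hηe]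
  ring

theorem signProd_reflection {H : Arrangement V} {e : V} (he : e ∈ H.normals)
    (hw : Preserves (hyperplane e).reflection H.normals) (x : V) :
    signProd H.normals ((hyperplane e).reflection x) = -signProd H.normals x := by
  rw [signProd, signProd, normalProd_reflection he hw, Left.sign_neg]
  simp

end Reflections

/-! ### Moments of the sign on the unit sphere and their vanishing in low degree. -/

section Moments

open Metric

variable {V : Type*} [NormedAddCommGroup V] [InnerProductSpace ℝ V] [FiniteDimensional ℝ V]
  [MeasurableSpace V] [BorelSpace V]

/-- The moments of the signed measure on the unit sphere given by an arrangement. -/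
def sphereMoment (E : Finset V) (k : ℕ) (a : V) : ℝ :=
  ∫ u : sphere (0 : V) 1, signProd E u * ⟪a, (u : V)⟫ ^ k ∂(volume : Measure V).toSphere

theorem integrable_signProd_mul (E : Finset V) {g : sphere (0 : V) 1 → ℝ} (hg : Continuous g) :
    Integrable (fun u : sphere (0 : V) 1 => signProd E u * g u) (volume : Measure V).toSphere := by
  have hgi : Integrable g (volume : Measure V).toSphere :=
    (BoundedContinuousFunction.mkOfCompact ⟨g, hg⟩).integrable _
  refine hgi.bdd_mul (c := 1) ((measurable_signProd E).comp
    measurable_subtype_coe).aestronglyMeasurable (Filter.Eventually.of_forall fun u => ?_)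
  exact abs_signProd_le_one E u

theorem sphereMoment_reflection {H : Arrangement V} {e : V} (he : e ∈ H.normals)
    (hw : Preserves (hyperplane e).reflection H.normals) (k : ℕ) (a : V) :
    sphereMoment H.normals k ((hyperplane e).reflection a) = -sphereMoment H.normals k a := by
  unfold sphereMoment
  rw [← (measurePreserving_toSphere (hyperplane e).reflection).integral_comp
    (sphereIsometry _).toHomeomorph.measurableEmbedding, ← integral_neg]
  refine integral_congr_ae (Filter.Eventually.of_forall fun u => ?_)
  simp [signProd_reflection he hw]

/-- The moment changes sign under the reflection, which fixes `a`. -/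
theorem sphereMoment_eq_zero_of_mem {H : Arrangement V} {e : V} (he : e ∈ H.normals)
    (hw : Preserves (hyperplane e).reflection H.normals) (k : ℕ) {a : V} (ha : ⟪e, a⟫ = 0) :
    sphereMoment H.normals k a = 0 := by
  have h := sphereMoment_reflection he hw k a
  rw [Submodule.reflection_mem_subspace_eq_self ((mem_hyperplane_iff e a).2 ha)] at h
  linarith

theorem exists_polynomial_sphereMoment (E : Finset V) (k : ℕ) (x v : V) :
    ∃ p : Polynomial ℝ, p.natDegree ≤ k ∧ ∀ t, sphereMoment E k (x + t • v) = p.eval t := by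
  refine ⟨∑ j ∈ Finset.range (k + 1), Polynomial.C ((∫ u : sphere (0 : V) 1,
    signProd E u * (⟪v, (u : V)⟫ ^ j * ⟪x, (u : V)⟫ ^ (k - j)) ∂(volume : Measure V).toSphere) *
      k.choose j) * Polynomial.X ^ j, ?_, fun t => ?_⟩
  · refine Polynomial.natDegree_sum_le_of_forall_le _ _ fun j hj => ?_
    exact (Polynomial.natDegree_C_mul_X_pow_le _ _).trans (by simpa [Nat.lt_succ_iff] using hj)
  · simp only [Polynomial.eval_finsetSum, Polynomial.eval_mul, Polynomial.eval_C,
      Polynomial.eval_pow, Polynomial.eval_X]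
    unfold sphereMoment
    have : ∀ u : sphere (0 : V) 1, signProd E u * ⟪x + t • v, (u : V)⟫ ^ k =
        ∑ j ∈ Finset.range (k + 1), (signProd E u * (⟪v, (u : V)⟫ ^ j * ⟪x, (u : V)⟫ ^ (k - j))) *
          (k.choose j * t ^ j) := by
      intro u
      rw [inner_add_left, real_inner_smul_left, add_comm, add_pow, Finset.mul_sum]
      refine Finset.sum_congr rfl fun j _ => ?_
      ring
    simp_rw [this]
    rw [integral_finsetSum]
    · refine Finset.sum_congr rfl fun j _ => ?_
      rw [integral_mul_const, mul_assoc]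
    · exact fun j _ => (integrable_signProd_mul E (by fun_prop)).mul_const _

theorem continuous_sphereMoment (E : Finset V) (k : ℕ) : Continuous (sphereMoment E k) := by
  unfold sphereMoment
  refine continuous_iff_continuousAt.2 fun a => ?_
  refine continuousAt_of_dominated (bound := fun _ => (‖a‖ + 1) ^ k) ?_ ?_ ?_ ?_
  · exact Filter.Eventually.of_forall fun x =>
      (integrable_signProd_mul E (by fun_prop)).aestronglyMeasurable
  · filter_upwards [Metric.ball_mem_nhds a one_pos] with x hx
    refine Filter.Eventually.of_forall fun u => ?_
    rw [norm_mul, norm_pow]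
    have h1 : ‖signProd E (u : V)‖ ≤ 1 := abs_signProd_le_one E u
    have h2 : ‖⟪x, (u : V)⟫‖ ≤ ‖a‖ + 1 := by
      refine (norm_inner_le_norm x (u : V)).trans ?_
      have : ‖x - a‖ < 1 := by simpa [dist_eq_norm] using hx
      rw [norm_eq_of_mem_sphere, mul_one]
      linarith [norm_le_norm_sub_add x a]
    calc ‖signProd E (u : V)‖ * ‖⟪x, (u : V)⟫‖ ^ k ≤ 1 * (‖a‖ + 1) ^ k := by gcongr
      _ = _ := one_mul _
  · exact integrable_const _
  · exact Filter.Eventually.of_forall fun u => by fun_prop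

theorem dense_inner_ne_zero {s : Finset V} (hs : ∀ g ∈ s, g ≠ 0) :
    Dense {x : V | ∀ g ∈ s, ⟪g, x⟫ ≠ 0} := by
  have : ∀ᵐ x : V, ∀ g ∈ s, ⟪g, x⟫ ≠ 0 := by
    refine (Finset.eventually_all _).2 fun g hg => ?_
    have h0 : volume (hyperplane g : Set V) = 0 := by
      refine Measure.addHaar_submodule _ _ fun htop => hs g hg ?_
      have : g ∈ hyperplane g := htop ▸ Submodule.mem_top
      rwa [mem_hyperplane_iff, inner_self_eq_zero] at this
    filter_upwards [measure_eq_zero_iff_ae_notMem.1 h0] with x hx h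
    exact hx ((mem_hyperplane_iff g x).2 h)
  exact Measure.dense_of_ae this

/-- A generic line in a direction `v` of the base chamber meets the hyperplanes of `E'` in `E'.card`
distinct points. The moment restricted to it is a polynomial of degree at most `k` with more than
`k` roots; density of generic lines and continuity finish. -/
theorem sphereMoment_eq_zero {H : Arrangement V} {E' : Finset V} (hE' : E' ⊆ H.normals)
    (hw : ∀ e ∈ E', Preserves (hyperplane e).reflection H.normals) {k : ℕ} (hk : k < E'.card)
    (a : V) : sphereMoment H.normals k a = 0 := by
  classical
  obtain ⟨v, hv⟩ := H.exists_base_point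
  -- The line `x + t • v` meets the hyperplanes of `e` and `f` at the same `t` exactly when `x` is
  -- orthogonal to this vector.
  set G : Finset V := E'.offDiag.image fun p => ⟪p.2, v⟫ • p.1 - ⟪p.1, v⟫ • p.2
  have hG : ∀ g ∈ G, g ≠ 0 := by
    intro g hg h0
    obtain ⟨⟨e, f⟩, hp, rfl⟩ := Finset.mem_image.1 hg
    obtain ⟨he, hf, hne⟩ := Finset.mem_offDiag.1 hp
    have he1 := H.norm_eq_one e (hE' he)
    have hf1 := H.norm_eq_one f (hE' hf)
    have hev := hv e (hE' he)
    have hfv := hv f (hE' hf)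
    dsimp only at h0 hne
    rw [sub_eq_zero] at h0
    have hn := congrArg norm h0
    rw [norm_smul, norm_smul, he1, hf1, mul_one, mul_one, Real.norm_of_nonneg hev.le,
      Real.norm_of_nonneg hfv.le] at hn
    rw [hn] at h0
    exact hne (smul_right_injective V hev.ne' h0)
  have hdense := dense_inner_ne_zero hG
  have hzero : ∀ x ∈ {x : V | ∀ g ∈ G, ⟪g, x⟫ ≠ 0}, sphereMoment H.normals k x = 0 := by
    intro x hx
    obtain ⟨p, hp, hpe⟩ := exists_polynomial_sphereMoment H.normals k x v
    have hp0 : p = 0 := by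
      refine Polynomial.eq_zero_of_natDegree_lt_card_of_eval_eq_zero p
        (f := fun e : E' => -⟪(e : V), x⟫ / ⟪(e : V), v⟫) ?_ ?_ (by simpa using hp.trans_lt hk)
      · rintro ⟨e, he⟩ ⟨f, hf⟩ hef
        by_contra hne
        have hne' : e ≠ f := fun h => hne (Subtype.ext h)
        have hev := (hv e (hE' he)).ne'
        have hfv := (hv f (hE' hf)).ne'
        refine hx _ (Finset.mem_image_of_mem _ (Finset.mem_offDiag.2
          (show (e, f).1 ∈ E' ∧ (e, f).2 ∈ E' ∧ (e, f).1 ≠ (e, f).2 from ⟨he, hf, hne'⟩))) ?_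
        dsimp only at hef
        rw [div_eq_div_iff hev hfv] at hef
        rw [inner_sub_left, real_inner_smul_left, real_inner_smul_left]
        linarith
      · rintro ⟨e, he⟩
        rw [← hpe]
        refine sphereMoment_eq_zero_of_mem (hE' he) (hw e he) k ?_
        have hev := (hv e (hE' he)).ne'
        rw [inner_add_right, inner_smul_right]
        field_simp
        ring
    have := hpe 0
    simpa [hp0] using this
  have hclosed : IsClosed {x | sphereMoment H.normals k x = 0} :=
    isClosed_eq (continuous_sphereMoment _ _) continuous_const
  exact (hclosed.closure_subset_iff.2 hzero) (hdense a)

end Moments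

/-! ### The signed volume of a ball in polar coordinates about the origin. -/

section BallIntegral

open Metric

/-- The numbers `t ± D` are the roots of `X² - 2tX - c`, so their power sums satisfy `s (k + 2) = 2
* t * s (k + 1) + c * s k`. -/
theorem exists_polynomial_add_pow (c : ℝ) (n : ℕ) :
    ∃ p : Polynomial ℝ, p.natDegree ≤ n ∧ ∀ t D : ℝ, D ^ 2 = t ^ 2 + c →
      (t + D) ^ (n + 1) + (t - D) ^ (n + 1) = (2 * t) ^ (n + 1) + p.eval t := by
  induction n using Nat.strong_induction_on with
  | _ n ih =>
    match n with
    | 0 => exact ⟨0, by simp, fun t D _ => by simp; ring⟩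
    | 1 =>
      refine ⟨Polynomial.C (2 * c), (Polynomial.natDegree_C _).trans_le zero_le_one, fun t D h => ?_⟩
      rw [Polynomial.eval_C]
      linear_combination 2 * h
    | n + 2 =>
      obtain ⟨p, hp, hpe⟩ := ih n (by omega)
      obtain ⟨q, hq, hqe⟩ := ih (n + 1) (by omega)
      refine ⟨Polynomial.C 2 * (Polynomial.X * q) + Polynomial.C c *
        (Polynomial.C (2 ^ (n + 1)) * Polynomial.X ^ (n + 1) + p), ?_, fun t D h => ?_⟩
      · refine Polynomial.natDegree_add_le_of_degree_le ?_ ?_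
        · refine (Polynomial.natDegree_C_mul_le _ _).trans (Polynomial.natDegree_mul_le.trans ?_)
          have := Polynomial.natDegree_X_le (R := ℝ)
          omega
        · refine (Polynomial.natDegree_C_mul_le _ _).trans
            (Polynomial.natDegree_add_le_of_degree_le ?_ (by omega))
          exact (Polynomial.natDegree_C_mul_X_pow_le _ _).trans (by omega)
      · have h1 := hpe t D h
        have h2 := hqe t D h
        simp only [Polynomial.eval_add, Polynomial.eval_mul, Polynomial.eval_C,
          Polynomial.eval_X, Polynomial.eval_pow]
        have h3 : (t + D) ^ (n + 2 + 1) + (t - D) ^ (n + 2 + 1) =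
            2 * t * ((t + D) ^ (n + 1 + 1) + (t - D) ^ (n + 1 + 1)) +
              c * ((t + D) ^ (n + 1) + (t - D) ^ (n + 1)) := by
          have hd : c = D ^ 2 - t ^ 2 := by linarith
          rw [hd]
          ring
        rw [h3, h1, h2]
        ring

variable {V : Type*} [NormedAddCommGroup V] [InnerProductSpace ℝ V]

/-- Membership is a quadratic inequality in `r`; its smaller root is nonpositive since the ball
contains the origin, leaving only the upper bound. -/
theorem smul_mem_closedBall_iff {a u : V} (hu : ‖u‖ = 1) {R r : ℝ} (hR : ‖a‖ ≤ R) (hr : 0 < r) :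
    r • u ∈ closedBall a R ↔ r ≤ ⟪a, u⟫ + √(⟪a, u⟫ ^ 2 + (R ^ 2 - ‖a‖ ^ 2)) := by
  have hR0 : 0 ≤ R := (norm_nonneg a).trans hR
  have hc : 0 ≤ R ^ 2 - ‖a‖ ^ 2 := by nlinarith [norm_nonneg a]
  have hsq : ‖r • u - a‖ ^ 2 = (r - ⟪a, u⟫) ^ 2 + ‖a‖ ^ 2 - ⟪a, u⟫ ^ 2 := by
    rw [norm_sub_sq_real, norm_smul, hu, real_inner_smul_left, real_inner_comm, mul_one,
      Real.norm_eq_abs, sq_abs]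
    ring
  rw [mem_closedBall, dist_eq_norm, ← sq_le_sq₀ (norm_nonneg _) hR0, hsq, ← sub_le_iff_le_add']
  have hs : |⟪a, u⟫| ≤ √(⟪a, u⟫ ^ 2 + (R ^ 2 - ‖a‖ ^ 2)) :=
    Real.abs_le_sqrt (by linarith)
  constructor
  · intro h
    refine (le_abs_self _).trans (Real.abs_le_sqrt ?_)
    linarith
  · intro h
    have habs : |r - ⟪a, u⟫| ≤ √(⟪a, u⟫ ^ 2 + (R ^ 2 - ‖a‖ ^ 2)) :=
      abs_le.2 ⟨by linarith [(le_abs_self ⟪a, u⟫).trans hs], h⟩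
    have := (Real.le_sqrt (abs_nonneg _) (by positivity)).1 habs
    rw [sq_abs] at this
    linarith

variable [FiniteDimensional ℝ V] [MeasurableSpace V] [BorelSpace V]

theorem integrable_indicator_signProd (E : Finset V) (a : V) (R : ℝ) :
    Integrable ((closedBall a R).indicator (signProd E)) := by
  have hfin : IsFiniteMeasure (volume.restrict (closedBall a R)) :=
    ⟨by simpa using measure_closedBall_lt_top⟩
  refine IntegrableOn.integrable_indicator ?_ measurableSet_closedBall
  refine Integrable.of_bound (measurable_signProd E).aestronglyMeasurable 1
    (Filter.Eventually.of_forall fun x => abs_signProd_le_one E x)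

variable [Nontrivial V]

theorem integral_closedBall_signProd (E : Finset V) {a : V} {R : ℝ} (hR : ‖a‖ ≤ R) :
    ∫ x in closedBall a R, signProd E x =
      ∫ u : sphere (0 : V) 1, signProd E u *
        ((⟪a, (u : V)⟫ + √(⟪a, (u : V)⟫ ^ 2 + (R ^ 2 - ‖a‖ ^ 2))) ^ finrank ℝ V / finrank ℝ V)
          ∂(volume : Measure V).toSphere := by
  have hn : 0 < finrank ℝ V := finrank_pos
  have hR0 : 0 ≤ R := (norm_nonneg a).trans hR
  have hc : 0 ≤ R ^ 2 - ‖a‖ ^ 2 := by nlinarith [norm_nonneg a]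
  rw [← integral_indicator measurableSet_closedBall, integral_polar,
    integral_prod _ (integrable_polar (integrable_indicator_signProd E a R))]
  refine integral_congr_ae (Filter.Eventually.of_forall fun u => ?_)
  set ρ := ⟪a, (u : V)⟫ + √(⟪a, (u : V)⟫ ^ 2 + (R ^ 2 - ‖a‖ ^ 2)) with hρ
  have hρ0 : 0 ≤ ρ := by
    have : |⟪a, (u : V)⟫| ≤ √(⟪a, (u : V)⟫ ^ 2 + (R ^ 2 - ‖a‖ ^ 2)) :=
      Real.abs_le_sqrt (by linarith)
    linarith [(abs_le.1 this).1, neg_abs_le ⟪a, (u : V)⟫]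
  have h := integral_volumeIoiPow (finrank ℝ V - 1)
    (fun r => (closedBall a R).indicator (signProd E) (r • (u : V)))
  refine h.trans ?_
  have hind : ∀ r ∈ Set.Ioi (0 : ℝ), r ^ (finrank ℝ V - 1) *
      (closedBall a R).indicator (signProd E) (r • (u : V)) =
      (Set.Iic ρ).indicator (fun r => r ^ (finrank ℝ V - 1) * signProd E u) r := by
    intro r hr
    have hiff : r • (u : V) ∈ closedBall a R ↔ r ∈ Set.Iic ρ :=
      smul_mem_closedBall_iff (norm_eq_of_mem_sphere u) hR hr
    by_cases hm : r ∈ Set.Iic ρ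
    · rw [Set.indicator_of_mem hm, Set.indicator_of_mem (hiff.2 hm), signProd_smul E hr]
    · rw [Set.indicator_of_notMem hm, Set.indicator_of_notMem (fun h => hm (hiff.1 h)), mul_zero]
  rw [setIntegral_congr_fun measurableSet_Ioi hind, setIntegral_indicator measurableSet_Iic,
    Set.Ioi_inter_Iic, integral_mul_const, ← intervalIntegral.integral_of_le hρ0, integral_pow,
    Nat.sub_add_cancel hn, zero_pow hn.ne', sub_zero, mul_comm, Nat.cast_sub hn]
  simp [hρ]

/-- Under the parity condition, the signed volume of a ball containing the origin only depends on
its center, provided the moments of low degree vanish. -/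
theorem integral_closedBall_signProd_eq (E : Finset V) (hE : E.card ≡ finrank ℝ V [MOD 2]) {a : V}
    (ha : ∀ k < finrank ℝ V, sphereMoment E k a = 0) {R : ℝ} (hR : ‖a‖ ≤ R) :
    ∫ x in closedBall a R, signProd E x =
      2 ^ finrank ℝ V / (2 * finrank ℝ V) * sphereMoment E (finrank ℝ V) a := by
  rw [integral_closedBall_signProd E hR]
  have hR0 : 0 ≤ R := (norm_nonneg a).trans hR
  have hc : 0 ≤ R ^ 2 - ‖a‖ ^ 2 := by nlinarith [norm_nonneg a]
  have hn : 0 < finrank ℝ V := finrank_pos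
  set n := finrank ℝ V
  obtain ⟨m, hm⟩ : ∃ m, n = m + 1 := ⟨n - 1, by omega⟩
  obtain ⟨p, hp, hpe⟩ := exists_polynomial_add_pow (R ^ 2 - ‖a‖ ^ 2) m
  rw [← hm] at hpe
  set ν := (volume : Measure V).toSphere
  set ψ : sphere (0 : V) 1 → ℝ := fun u => signProd E u *
        ((⟪a, (u : V)⟫ + √(⟪a, (u : V)⟫ ^ 2 + (R ^ 2 - ‖a‖ ^ 2))) ^ n / n) with hψ
  have hψi : Integrable ψ ν := integrable_signProd_mul E (by fun_prop)
  have hmp := measurePreserving_toSphere (LinearIsometryEquiv.neg ℝ (E := V))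
  have hemb := (sphereIsometry (LinearIsometryEquiv.neg ℝ (E := V))).toHomeomorph.measurableEmbedding
  have hneg : ∫ u, ψ (sphereIsometry (LinearIsometryEquiv.neg ℝ) u) ∂ν = ∫ u, ψ u ∂ν :=
    hmp.integral_comp hemb ψ
  have hnegi : Integrable (fun u => ψ (sphereIsometry (LinearIsometryEquiv.neg ℝ) u)) ν :=
    (hmp.integrable_comp_emb hemb).2 hψi
  have hpar : (-1 : ℝ) ^ E.card = (-1) ^ n := by
    rw [← Nat.mod_add_div E.card 2, ← Nat.mod_add_div n 2, hE]
    simp [pow_add, pow_mul]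
  -- At `-u` the radius is `-t + D` and, by parity, the sign gains `(-1)^n`; together they produce
  -- the term `(t - D)^n` of `exists_polynomial_add_pow`.
  have hsum : ∀ u, ψ u + ψ (sphereIsometry (LinearIsometryEquiv.neg ℝ) u) =
      2 ^ n / n * (signProd E u * ⟪a, (u : V)⟫ ^ n) +
        ∑ k ∈ Finset.range n, p.coeff k / n * (signProd E u * ⟪a, (u : V)⟫ ^ k) := by
    intro u
    have h1 := hpe ⟪a, (u : V)⟫ (√(⟪a, (u : V)⟫ ^ 2 + (R ^ 2 - ‖a‖ ^ 2)))
      (Real.sq_sqrt (by positivity))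
    rw [Polynomial.eval_eq_sum_range' (n := n) (by omega), mul_pow] at h1
    have h2 : (-1 : ℝ) ^ n * (-⟪a, (u : V)⟫ + √(⟪a, (u : V)⟫ ^ 2 + (R ^ 2 - ‖a‖ ^ 2))) ^ n =
        (⟪a, (u : V)⟫ - √(⟪a, (u : V)⟫ ^ 2 + (R ^ 2 - ‖a‖ ^ 2))) ^ n := by
      rw [← mul_pow]
      congr 1
      ring
    have h3 : ∑ k ∈ Finset.range n, p.coeff k / n * (signProd E u * ⟪a, (u : V)⟫ ^ k) =
        signProd E u / n * ∑ k ∈ Finset.range n, p.coeff k * ⟪a, (u : V)⟫ ^ k := by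
      rw [Finset.mul_sum]
      exact Finset.sum_congr rfl fun k _ => by ring
    rw [h3]
    simp only [hψ, coe_sphereIsometry, LinearIsometryEquiv.coe_neg, signProd_neg, hpar,
      inner_neg_right, neg_sq]
    linear_combination (signProd E u / n) * h1 + (signProd E u / n) * h2
  have h2 : 2 * ∫ u, ψ u ∂ν = 2 ^ n / n * sphereMoment E n a := by
    have h3 : (∫ u, ψ u ∂ν) + ∫ u, ψ (sphereIsometry (LinearIsometryEquiv.neg ℝ) u) ∂ν =
        2 ^ n / n * sphereMoment E n a := by
      rw [← integral_add hψi hnegi, integral_congr_ae (Filter.Eventually.of_forall hsum),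
        integral_add ((integrable_signProd_mul E (by fun_prop)).const_mul _)
          (integrable_finsetSum _ fun k _ =>
            (integrable_signProd_mul E (by fun_prop)).const_mul _),
        integral_finsetSum _ fun k _ => (integrable_signProd_mul E (by fun_prop)).const_mul _,
        integral_const_mul]
      simp only [integral_const_mul]
      rw [Finset.sum_eq_zero, add_zero]
      · rfl
      · intro k hk
        have := ha k (Finset.mem_range.1 hk)
        unfold sphereMoment at this
        rw [this, mul_zero]
    rw [hneg] at h3
    linarith
  have h3 : ∫ u, ψ u ∂ν = (2 ^ n / n * sphereMoment E n a) / 2 := by linarith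
  rw [h3]
  ring

end BallIntegral

/-! ### Differentiating the signed volume of a ball in its radius. -/

section SphericalIntegral

open Metric Filter Topology

variable {V : Type*} [NormedAddCommGroup V] [InnerProductSpace ℝ V]

theorem continuousAt_signProd {E : Finset V} {x : V} (hx : x ∈ complement E) :
    ContinuousAt (signProd E) x := by
  have h0 : normalProd E x ≠ 0 := fun h => by
    obtain ⟨e, he, h⟩ := normalProd_eq_zero_iff.1 h
    exact mem_complement_iff.1 hx e he h
  have h1 : ContinuousAt (fun y => SignType.sign (normalProd E y)) x :=
    (continuousAt_sign_of_ne_zero h0).comp (continuous_normalProd E).continuousAt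
  exact (continuous_of_discreteTopology (f := fun s : SignType => (s : ℝ))).continuousAt.comp h1

variable [FiniteDimensional ℝ V] [MeasurableSpace V] [BorelSpace V]

/-- The integral of the sign of an arrangement over a sphere, in polar coordinates. -/
def sphericalIntegral (E : Finset V) (a : V) (r : ℝ) : ℝ :=
  ∫ u : sphere (0 : V) 1, signProd E (a + r • (u : V)) ∂(volume : Measure V).toSphere

theorem measurable_sphericalIntegral (E : Finset V) (a : V) :
    StronglyMeasurable (sphericalIntegral E a) := by
  have : StronglyMeasurable (fun p : ℝ × sphere (0 : V) 1 => signProd E (a + p.1 • (p.2 : V))) :=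
    ((measurable_signProd E).comp (by fun_prop)).stronglyMeasurable
  exact this.integral_prod_right

theorem abs_sphericalIntegral_le (E : Finset V) (a : V) (r : ℝ) :
    ‖sphericalIntegral E a r‖ ≤ (volume : Measure V).toSphere.real Set.univ := by
  have := norm_integral_le_of_norm_le_const (μ := (volume : Measure V).toSphere) (C := 1)
    (f := fun u : sphere (0 : V) 1 => signProd E (a + r • (u : V)))
    (Eventually.of_forall fun u => abs_signProd_le_one E _)
  rw [one_mul] at this
  exact this

/-- The sign is continuous off the hyperplanes and bounded by 1, so dominated convergence applies.
-/
theorem continuousAt_sphericalIntegral {E : Finset V} {a : V} {R : ℝ}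
    (h : ∀ᵐ u : sphere (0 : V) 1 ∂(volume : Measure V).toSphere,
      a + R • (u : V) ∈ complement E) : ContinuousAt (sphericalIntegral E a) R := by
  refine continuousAt_of_dominated (bound := fun _ => 1) ?_ ?_ (integrable_const _) ?_
  · exact Eventually.of_forall fun r =>
      ((measurable_signProd E).comp (by fun_prop)).aestronglyMeasurable
  · exact Eventually.of_forall fun r => Eventually.of_forall fun u => abs_signProd_le_one E _
  · filter_upwards [h] with u hu
    exact ContinuousAt.comp (f := fun r : ℝ => a + r • (u : V)) (continuousAt_signProd hu)
      (by fun_prop)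

/-- Here the polar coordinates are centred at `a`, so that the radius of the ball becomes the upper
limit of integration. -/
theorem integral_closedBall_eq_intervalIntegral [Nontrivial V] (E : Finset V) (a : V) {R : ℝ}
    (hR : 0 ≤ R) : ∫ x in closedBall a R, signProd E x =
      ∫ r in (0 : ℝ)..R, r ^ (finrank ℝ V - 1) * sphericalIntegral E a r := by
  have hint := (integrable_indicator_signProd E a R).comp_add_left a
  rw [← integral_indicator measurableSet_closedBall,
    ← integral_add_left_eq_self (μ := volume) _ a, integral_polar,
    integral_prod_symm _ (integrable_polar hint)]
  have hin : ∀ r ∈ Set.Ioi (0 : ℝ), ∫ u : sphere (0 : V) 1,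
      (closedBall a R).indicator (signProd E) (a + r • (u : V)) ∂(volume : Measure V).toSphere =
        (Set.Iic R).indicator (sphericalIntegral E a) r := by
    intro r hr
    have hmem : ∀ u : sphere (0 : V) 1, a + r • (u : V) ∈ closedBall a R ↔ r ∈ Set.Iic R := by
      intro u
      simp [norm_smul, abs_of_pos (Set.mem_Ioi.1 hr)]
    by_cases h : r ∈ Set.Iic R
    · simp only [Set.indicator_of_mem h, Set.indicator_of_mem ((hmem _).2 h)]
      rfl
    · simp only [Set.indicator_of_notMem h, Set.indicator_of_notMem (fun h' => h ((hmem _).1 h'))]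
      simp
  rw [integral_volumeIoiPow _ (fun r => ∫ u : sphere (0 : V) 1,
      (closedBall a R).indicator (signProd E) (a + r • (u : V)) ∂(volume : Measure V).toSphere),
    intervalIntegral.integral_of_le hR, ← Set.Ioi_inter_Iic,
    ← setIntegral_indicator measurableSet_Iic]
  refine setIntegral_congr_fun measurableSet_Ioi fun r hr => ?_
  rw [hin r hr, Set.indicator_mul_right]

/-- Where the signed volume of a ball does not depend on the radius, the signed area of its
boundary vanishes. -/
theorem sphericalIntegral_eq_zero [Nontrivial V] {E : Finset V} {a : V} {R : ℝ} (hR : 0 < R)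
    (hconst : ∀ r, R ≤ r →
      ∫ x in closedBall a r, signProd E x = ∫ x in closedBall a R, signProd E x)
    (h : ∀ᵐ u : sphere (0 : V) 1 ∂(volume : Measure V).toSphere,
      a + R • (u : V) ∈ complement E) : sphericalIntegral E a R = 0 := by
  set f : ℝ → ℝ := fun r => r ^ (finrank ℝ V - 1) * sphericalIntegral E a r with hf
  have hfm : StronglyMeasurable f :=
    (continuous_pow _).stronglyMeasurable.mul (measurable_sphericalIntegral E a)
  have hfi : IntervalIntegrable f volume 0 R := by
    have h1 : IntervalIntegrable (fun r : ℝ => r ^ (finrank ℝ V - 1)) volume 0 R :=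
      (continuous_pow _).intervalIntegrable _ _
    rw [intervalIntegrable_iff] at h1 ⊢
    exact Integrable.mul_bdd h1 (measurable_sphericalIntegral E a).aestronglyMeasurable
      (Eventually.of_forall fun r => abs_sphericalIntegral_le E a r)
  have hfc : ContinuousAt f R :=
    (continuous_pow _).continuousAt.mul (continuousAt_sphericalIntegral h)
  -- Constancy is known only for radii at least `R`, so only the right derivative is compared; this
  -- covers `R = ‖a‖`.
  have hderiv : HasDerivWithinAt (fun x => ∫ r in (0 : ℝ)..x, f r) (f R) (Set.Ici R) R :=
    intervalIntegral.integral_hasDerivWithinAt_right hfi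
      hfm.stronglyMeasurableAtFilter hfc.continuousWithinAt (t := Set.Ioi R)
  have hzero : HasDerivWithinAt (fun x => ∫ r in (0 : ℝ)..x, f r) 0 (Set.Ici R) R := by
    refine (hasDerivWithinAt_const R (Set.Ici R) (∫ r in (0 : ℝ)..R, f r)).congr
      (fun x hx => ?_) rfl
    rw [← integral_closedBall_eq_intervalIntegral E a (hR.le.trans hx),
      ← integral_closedBall_eq_intervalIntegral E a hR.le]
    exact hconst x hx
  have := (uniqueDiffWithinAt_Ici R).eq_deriv _ hderiv hzero
  exact (mul_eq_zero.1 this).resolve_left (pow_pos hR _).ne'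

end SphericalIntegral

/-! ### Transfer from the unit sphere to an arbitrary sphere. -/

section SphereScaling

open Metric
open scoped Pointwise

variable {V : Type*} [NormedAddCommGroup V] [InnerProductSpace ℝ V]

theorem sphere_inter_eq_image (a : V) {R : ℝ} (hR : 0 < R) (T : Set V) :
    sphere a R ∩ T = (fun u : sphere (0 : V) 1 => a + R • (u : V)) ''
      ((fun u : sphere (0 : V) 1 => a + R • (u : V)) ⁻¹' T) := by
  rw [Set.image_preimage_eq_inter_range, Set.inter_comm]
  congr 1
  ext x
  constructor
  · intro hx
    have h1 : ‖x - a‖ = R := by simpa [dist_eq_norm] using hx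
    refine ⟨⟨R⁻¹ • (x - a), ?_⟩, ?_⟩
    · simp [norm_smul, h1, abs_of_pos hR, hR.ne']
    · simp [smul_smul, hR.ne']
  · rintro ⟨u, rfl⟩
    simp [norm_smul, hR.le]

variable [MeasurableSpace V] [BorelSpace V]

theorem euclideanHausdorffMeasure_image_unitSphere (d : ℕ) (a : V) {R : ℝ} (hR : R ≠ 0)
    (A : Set (sphere (0 : V) 1)) :
    μHE[d] ((fun u : sphere (0 : V) 1 => a + R • (u : V)) '' A) = ‖R‖₊ ^ d • μHE[d] A := by
  have : (fun u : sphere (0 : V) 1 => a + R • (u : V)) '' A =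
      a +ᵥ (R • (((↑) : sphere (0 : V) 1 → V) '' A)) := by
    rw [← Set.image_smul, ← Set.image_vadd, Set.image_image, Set.image_image]
    rfl
  rw [this, measure_vadd, Measure.euclideanHausdorffMeasure_smul₀ d hR,
    (show Isometry ((↑) : sphere (0 : V) 1 → V) from
      isometry_subtype_coe).euclideanHausdorffMeasure_image]

variable [FiniteDimensional ℝ V]

theorem ae_add_smul_mem_complement [Nontrivial V] (H : Arrangement V) {a : V} {R : ℝ} (hR : 0 < R)
    (h : 2 ≤ finrank ℝ V ∨ ‖a‖ < R) :
    ∀ᵐ u : sphere (0 : V) 1 ∂μHE[finrank ℝ V - 1], a + R • (u : V) ∈ complement H.normals := by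
  refine (Finset.eventually_all _).2 fun e he => ?_
  have h0 := euclideanHausdorffMeasure_sphere_inter_hyperplane (H.normal_ne_zero he) hR h
  rw [sphere_inter_eq_image a hR, euclideanHausdorffMeasure_image_unitSphere _ _ hR.ne',
    ENNReal.smul_def, smul_eq_mul, mul_eq_zero] at h0
  refine measure_eq_zero_iff_ae_notMem.1 (h0.resolve_left ?_)
  simp [hR.ne']

end SphereScaling

/-! ### Flat and spherical parts of the boundary, and the vanishing of the alternating sum. -/

namespace Arrangement

open Metric

variable {V : Type*} [NormedAddCommGroup V] [InnerProductSpace ℝ V] (H : Arrangement V)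

theorem mem_of_mem_closure {T : Set V} (hT : T ∈ H.chamberFinset) {x : V} (hx : x ∈ closure T)
    (hxc : x ∈ complement H.normals) : x ∈ T := by
  obtain ⟨z, hz, rfl⟩ := H.mem_chamberFinset.1 hT
  rw [closure_chamberAt hz] at hx
  exact fun e he => lt_of_le_of_ne (hx e he)
    (mul_ne_zero (mem_complement_iff.1 hz e he) (mem_complement_iff.1 hxc e he)).symm

theorem subset_complement {T : Set V} (hT : T ∈ H.chamberFinset) : T ⊆ complement H.normals := by
  obtain ⟨z, -, rfl⟩ := H.mem_chamberFinset.1 hT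
  exact chamberAt_subset_complement _ _

theorem zero_mem_closure {T : Set V} (hT : T ∈ H.chamberFinset) : (0 : V) ∈ closure T := by
  obtain ⟨z, hz, rfl⟩ := H.mem_chamberFinset.1 hT
  rw [closure_chamberAt hz]
  intro e _
  simp

theorem isClosed_compl_complement : IsClosed (complement H.normals)ᶜ := by
  have : (complement H.normals)ᶜ = normalProd H.normals ⁻¹' {0} := by
    ext x
    simp only [Set.mem_compl_iff, mem_complement_iff, Set.mem_preimage, Set.mem_singleton_iff,
      normalProd_eq_zero_iff]
    push Not
    rfl
  rw [this]
  exact isClosed_singleton.preimage (continuous_normalProd _)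

theorem sphere_zero_inter_eq_empty (hne : H.normals.Nonempty) {T : Set V}
    (hT : T ∈ H.chamberFinset) : sphere (0 : V) 0 ∩ T = ∅ := by
  obtain ⟨e, he⟩ := hne
  rw [sphere_zero, Set.singleton_inter_eq_empty]
  exact fun h => mem_complement_iff.1 (H.subset_complement hT h) e he (by simp)

/-- The boundary of the region cut out of a ball by a chamber consists of a spherical part and of
a part in the hyperplanes. -/
theorem frontier_closedBall_inter_closure [Nontrivial V] (hne : H.normals.Nonempty) {a : V} {R : ℝ}
    (hR : ‖a‖ ≤ R) {T : Set V} (hT : T ∈ H.chamberFinset) :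
    frontier (closedBall a R ∩ closure T) =
      (sphere a R ∩ T) ∪ ((closedBall a R \ complement H.normals) ∩ closure T) := by
  have hcl : IsClosed (closedBall a R ∩ closure T) := isClosed_closedBall.inter isClosed_closure
  rcases eq_or_ne R 0 with rfl | hR0
  · obtain rfl : a = 0 := norm_le_zero_iff.1 hR
    obtain ⟨e, he⟩ := hne
    have h0 : (0 : V) ∉ complement H.normals := fun h => mem_complement_iff.1 h e he (by simp)
    have h0T := H.zero_mem_closure hT
    have h1 : (0 : V) ∉ T := fun h => h0 (H.subset_complement hT h)
    rw [hcl.frontier_eq, closedBall_zero, sphere_zero, Set.inter_eq_left.2 (by simpa using h0T),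
      interior_singleton]
    ext x
    simp only [Set.mem_sdiff, Set.mem_singleton_iff, Set.mem_union, Set.mem_inter_iff,
      Set.mem_empty_iff_false, not_false_eq_true, and_true]
    constructor
    · rintro rfl
      exact Or.inr ⟨⟨rfl, h0⟩, h0T⟩
    · rintro (h | h)
      · exact h.1
      · exact h.1.1
  -- For `R ≠ 0` the interior of the region is the open ball intersected with the open chamber.
  · have hint : interior (closure T) = T := by
      obtain ⟨z, hz, rfl⟩ := H.mem_chamberFinset.1 hT
      exact interior_closure_chamberAt hz
    rw [hcl.frontier_eq, interior_inter, hint, interior_closedBall _ hR0]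
    ext x
    have h1 : x ∈ closure T → x ∈ complement H.normals → x ∈ T := H.mem_of_mem_closure hT
    have h2 : x ∈ T → x ∈ complement H.normals := fun h => H.subset_complement hT h
    have h3 : x ∈ T → x ∈ closure T := fun h => subset_closure h
    have h4 : x ∈ closedBall a R ↔ x ∈ ball a R ∨ x ∈ sphere a R := by
      rw [← ball_union_sphere, Set.mem_union]
    have h5 : x ∈ ball a R → x ∉ sphere a R := fun h h' => (mem_ball.1 h).ne (mem_sphere.1 h')
    simp only [Set.mem_sdiff, Set.mem_union, Set.mem_inter_iff]
    tauto

/-- In dimension 0 the exponent `finrank ℝ V - 1` truncates to 0, harmlessly, since all frontiers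
are empty. -/
theorem alternatingSurfaceSumVanishes_of_subsingleton [MeasurableSpace V] [BorelSpace V]
    [Subsingleton V] (a : V) (R : ℝ) :
    H.AlternatingSurfaceSumVanishes a R := by
  have h : ∀ X : Set V, surfaceMeasure X = 0 := fun X => by
    unfold surfaceMeasure
    have : frontier X = ∅ :=
      Set.eq_empty_of_forall_notMem fun x hx => hx.2 (by
        rw [(isOpen_discrete X).interior_eq]
        simpa using hx.1)
    rw [this, measure_empty]
  constructor
  · intro T _
    simp [h]
  · simp [h]

variable [FiniteDimensional ℝ V] [MeasurableSpace V] [BorelSpace V]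

theorem euclideanHausdorffMeasure_closedBall_diff_complement_lt_top (a : V) (R : ℝ) :
    μHE[finrank ℝ V - 1] (closedBall a R \ complement H.normals) < ⊤ := by
  have hsub : closedBall a R \ complement H.normals ⊆
      ⋃ e ∈ H.normals, (closedBall a R ∩ hyperplane e : Set V) := by
    rintro x ⟨hx, hxc⟩
    simp only [complement, Set.mem_ofPred_eq, not_forall, not_not] at hxc
    obtain ⟨e, he, hxe⟩ := hxc
    exact Set.mem_biUnion he ⟨hx, hxe⟩
  refine (measure_mono hsub).trans_lt (measure_biUnion_lt_top H.normals.finite_toSet fun e he => ?_)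
  exact euclideanHausdorffMeasure_closedBall_inter_hyperplane_lt_top (H.normal_ne_zero he) a R

/-- Intersections of two distinct hyperplanes are null, so almost every flat point lies on exactly
one hyperplane, where the integrand vanishes by `sum_sign_indicator_closure`. -/
theorem sum_sign_flat_part (a : V) (R : ℝ) :
    ∑ T ∈ H.chamberFinset, H.sign T * (μHE[finrank ℝ V - 1] : Measure V).real
      ((closedBall a R \ complement H.normals) ∩ closure T) = 0 := by
  set μ : Measure V := μHE[finrank ℝ V - 1]
  set L := closedBall a R \ complement H.normals with hL
  have hLm : MeasurableSet L :=
    (isClosed_closedBall.inter H.isClosed_compl_complement).measurableSet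
  have hfin : IsFiniteMeasure (μ.restrict L) :=
    ⟨by simpa using H.euclideanHausdorffMeasure_closedBall_diff_complement_lt_top a R⟩
  have hcl : ∀ T : Set V, MeasurableSet (closure T) := fun T => isClosed_closure.measurableSet
  have hsum : ∑ T ∈ H.chamberFinset, H.sign T * μ.real (L ∩ closure T) =
      ∫ x, ∑ T ∈ H.chamberFinset, H.sign T * (closure T).indicator (1 : V → ℝ) x
        ∂(μ.restrict L) := by
    rw [integral_finsetSum]
    · refine Finset.sum_congr rfl fun T _ => ?_
      rw [integral_const_mul, integral_indicator_one (hcl T),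
        measureReal_restrict_apply (hcl T), Set.inter_comm]
    · intro T _
      have : Integrable ((closure T).indicator (1 : V → ℝ)) (μ.restrict L) :=
        (integrable_const (1 : ℝ)).indicator (hcl T)
      exact this.const_mul _
  rw [hsum]
  have hgen : ∀ᵐ x ∂μ, ∀ e ∈ H.normals, ∀ f ∈ H.normals, f ≠ e →
      x ∉ (hyperplane e ∩ hyperplane f : Set V) := by
    refine (Finset.eventually_all _).2 fun e he => (Finset.eventually_all _).2 fun f hf => ?_
    by_cases hfe : f = e
    · simp [hfe]
    · have h0 := euclideanHausdorffMeasure_hyperplane_inter_hyperplane (H.norm_eq_one e he)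
        (H.norm_eq_one f hf) hfe (fun h => H.neg_notMem e he (h ▸ hf))
      filter_upwards [measure_eq_zero_iff_ae_notMem.1 h0] with x hx _
      exact hx
  refine integral_eq_zero_of_ae ((ae_restrict_iff' hLm).2 ?_)
  filter_upwards [hgen] with x hx hxL
  have hxc := hxL.2
  simp only [complement, Set.mem_ofPred_eq, not_forall, not_not] at hxc
  obtain ⟨e, he, hxe⟩ := hxc
  exact H.sum_sign_indicator_closure he ((mem_hyperplane_iff e x).1 hxe) fun f hf hfe h =>
    hx e he f hf hfe ⟨hxe, (mem_hyperplane_iff f x).2 h⟩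

theorem sphere_inter_lt_top (a : V) {R : ℝ} (hR : 0 < R) (T : Set V) :
    μHE[finrank ℝ V - 1] (sphere a R ∩ T) < ⊤ := by
  rw [sphere_inter_eq_image a hR, euclideanHausdorffMeasure_image_unitSphere _ _ hR.ne',
    ENNReal.smul_def, smul_eq_mul]
  exact ENNReal.mul_lt_top ENNReal.coe_lt_top (measure_lt_top _ _)

theorem sum_sign_sphere_part (a : V) {R : ℝ} (hR : 0 < R) :
    ∑ T ∈ H.chamberFinset, H.sign T * (μHE[finrank ℝ V - 1] : Measure V).real (sphere a R ∩ T) =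
      R ^ (finrank ℝ V - 1) * ∫ u : sphere (0 : V) 1, signProd H.normals (a + R • (u : V))
        ∂μHE[finrank ℝ V - 1] := by
  have hg : Measurable fun u : sphere (0 : V) 1 => a + R • (u : V) := by fun_prop
  rw [← H.sum_sign_mul_measureReal _ hg, Finset.mul_sum]
  refine Finset.sum_congr rfl fun T _ => ?_
  rw [sphere_inter_eq_image a hR, measureReal_def,
    euclideanHausdorffMeasure_image_unitSphere _ _ hR.ne', ENNReal.smul_def, smul_eq_mul,
    ENNReal.toReal_mul, measureReal_def]
  simp only [ENNReal.coe_toReal, NNReal.coe_pow, coe_nnnorm, Real.norm_of_nonneg hR.le]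
  ring

variable {H}

/-- The surface volumes alternate to zero when the pizza quantity does not depend on the radius. -/
theorem alternatingSurfaceSumVanishes_of_pizzaQuantity_const {a : V}
    (hconst : ∀ R₁ R₂ : ℝ, ‖a‖ ≤ R₁ → ‖a‖ ≤ R₂ →
      H.pizzaQuantity (closedBall a R₁) = H.pizzaQuantity (closedBall a R₂))
    {R : ℝ} (hR : ‖a‖ ≤ R) (hdeg : ¬ (finrank ℝ V = 1 ∧ R = ‖a‖ ∧ a ≠ 0)) :
    H.AlternatingSurfaceSumVanishes a R := by
  rcases subsingleton_or_nontrivial V with hV | hV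
  · exact H.alternatingSurfaceSumVanishes_of_subsingleton a R
  have hn : 0 < finrank ℝ V := finrank_pos
  have hR0 : 0 ≤ R := (norm_nonneg a).trans hR
  have hconst' : ∀ R₁ R₂ : ℝ, ‖a‖ ≤ R₁ → ‖a‖ ≤ R₂ → ∫ x in closedBall a R₂, signProd H.normals x =
      ∫ x in closedBall a R₁, signProd H.normals x := by
    intro R₁ R₂ h₁ h₂
    rw [← H.pizzaQuantity_eq_integral measure_closedBall_lt_top.ne,
      ← H.pizzaQuantity_eq_integral measure_closedBall_lt_top.ne]
    exact hconst R₂ R₁ h₂ h₁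
  -- Without hyperplanes the sign is 1 and the spherical integral is the positive mass of the
  -- sphere, contradicting constancy. Nonemptiness keeps the origin out of all chambers, as the case
  -- `R = 0` requires.
  have hne : H.normals.Nonempty := by
    by_contra hE
    rw [Finset.not_nonempty_iff_eq_empty] at hE
    have h := sphericalIntegral_eq_zero (E := H.normals) (a := a) (R := ‖a‖ + 1)
      (by positivity) (fun r hr => hconst' _ _ (by linarith) (by linarith))
      (by simp [hE, complement])
    have h1 : sphericalIntegral H.normals a (‖a‖ + 1) =
        (volume : Measure V).toSphere.real Set.univ := by
      simp [sphericalIntegral, hE, signProd, normalProd]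
    rw [h1, Measure.toSphere_real_apply_univ] at h
    have h2 : 0 < (volume : Measure V).real (ball 0 1) :=
      ENNReal.toReal_pos (measure_ball_pos _ _ one_pos).ne' measure_ball_lt_top.ne
    have h3 : (0 : ℝ) < finrank ℝ V := by exact_mod_cast hn
    exact (mul_pos h3 h2).ne' h
  have hsph_fin : ∀ T ∈ H.chamberFinset, μHE[finrank ℝ V - 1] (sphere a R ∩ T) < ⊤ := by
    intro T hT
    rcases hR0.eq_or_lt with h0 | h0
    · subst h0
      obtain rfl : a = 0 := norm_le_zero_iff.1 hR
      rw [H.sphere_zero_inter_eq_empty hne hT, measure_empty]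
      exact ENNReal.zero_lt_top
    · exact sphere_inter_lt_top a h0 T
  have hsph : ∑ T ∈ H.chamberFinset,
      H.sign T * (μHE[finrank ℝ V - 1] : Measure V).real (sphere a R ∩ T) = 0 := by
    rcases hR0.eq_or_lt with h0 | h0
    · subst h0
      obtain rfl : a = 0 := norm_le_zero_iff.1 hR
      refine Finset.sum_eq_zero fun T hT => ?_
      rw [H.sphere_zero_inter_eq_empty hne hT, measureReal_empty, mul_zero]
    · rw [H.sum_sign_sphere_part a h0]
      -- Proportionality requires a nonzero measure; for the zero measure the spherical part
      -- vanishes anyway.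
      by_cases hm : (μHE[finrank ℝ V - 1] : Measure (sphere (0 : V) 1)) = 0
      · simp [hm]
      obtain ⟨c, hc0, hct, hc⟩ := toSphere_eq_smul_euclideanHausdorffMeasure hm
      -- The excluded case is exactly the one where the sphere can meet a hyperplane in positive
      -- measure: in dimension 1 with `R = ‖a‖ > 0`, the origin is one of its two points.
      have hdim : 2 ≤ finrank ℝ V ∨ ‖a‖ < R := by
        by_contra hcon
        push Not at hcon
        have hRa : R = ‖a‖ := le_antisymm hcon.2 hR
        refine hdeg ⟨by omega, hRa, fun ha => ?_⟩
        rw [hRa, ha, norm_zero] at h0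
        exact lt_irrefl _ h0
      have hae : ∀ᵐ u : sphere (0 : V) 1 ∂(volume : Measure V).toSphere,
          a + R • (u : V) ∈ complement H.normals := by
        rw [hc]
        exact Measure.ae_smul_measure (ae_add_smul_mem_complement H h0 hdim) c
      have hz := sphericalIntegral_eq_zero h0 (fun r hr => hconst' _ _ hR (hR.trans hr)) hae
      unfold sphericalIntegral at hz
      rw [hc, integral_smul_measure, smul_eq_mul, mul_eq_zero] at hz
      rw [hz.resolve_left (ENNReal.toReal_ne_zero.2 ⟨hc0, hct⟩), mul_zero]
  have hflat_fin : ∀ T : Set V, μHE[finrank ℝ V - 1]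
      ((closedBall a R \ complement H.normals) ∩ closure T) < ⊤ := fun T =>
    (measure_mono Set.inter_subset_left).trans_lt
      (H.euclideanHausdorffMeasure_closedBall_diff_complement_lt_top a R)
  have hsplit : ∀ T ∈ H.chamberFinset, surfaceMeasure (closedBall a R ∩ closure T) =
      μHE[finrank ℝ V - 1] (sphere a R ∩ T) +
        μHE[finrank ℝ V - 1] ((closedBall a R \ complement H.normals) ∩ closure T) := by
    intro T hT
    rw [surfaceMeasure, H.frontier_closedBall_inter_closure hne hR hT, measure_union]
    · exact Set.disjoint_left.2 fun x hx hx' => hx'.1.2 (H.subset_complement hT hx.2)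
    · exact ((isClosed_closedBall.inter H.isClosed_compl_complement).inter
        isClosed_closure).measurableSet
  refine ⟨fun T hT => ?_, ?_⟩
  · rw [hsplit T hT]
    exact ENNReal.add_lt_top.2 ⟨hsph_fin T hT, hflat_fin T⟩
  · have : ∀ T ∈ H.chamberFinset,
        H.sign T * (surfaceMeasure (closedBall a R ∩ closure T)).toReal =
          H.sign T * (μHE[finrank ℝ V - 1] : Measure V).real (sphere a R ∩ T) +
            H.sign T * (μHE[finrank ℝ V - 1] : Measure V).real
              ((closedBall a R \ complement H.normals) ∩ closure T) := by
      intro T hT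
      rw [hsplit T hT, ENNReal.toReal_add (hsph_fin T hT).ne (hflat_fin T).ne, mul_add]
      rfl
    rw [Finset.sum_congr rfl this, Finset.sum_add_distrib, hsph, H.sum_sign_flat_part, add_zero]

/-- The pizza quantity of a ball containing the origin does not depend on its radius if the
arrangement has the right parity and is symmetric in sufficiently many of its hyperplanes. -/
theorem pizzaQuantity_closedBall_const (hpar : H.ParityCondition) {E' : Finset V}
    (hE' : E' ⊆ H.normals)
    (hw : ∀ e ∈ E', Preserves (hyperplane e).reflection H.normals) (hcard : finrank ℝ V ≤ E'.card)
    [Nontrivial V] {a : V} {R₁ R₂ : ℝ} (h₁ : ‖a‖ ≤ R₁) (h₂ : ‖a‖ ≤ R₂) :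
    H.pizzaQuantity (closedBall a R₁) = H.pizzaQuantity (closedBall a R₂) := by
  have hmom : ∀ k < finrank ℝ V, sphereMoment H.normals k a = 0 := fun k hk =>
    sphereMoment_eq_zero hE' hw (hk.trans_le hcard) a
  rw [H.pizzaQuantity_eq_integral measure_closedBall_lt_top.ne,
    H.pizzaQuantity_eq_integral measure_closedBall_lt_top.ne,
    integral_closedBall_signProd_eq _ hpar hmom h₁, integral_closedBall_signProd_eq _ hpar hmom h₂]

end Arrangement

end Pizza

end

theorem theorem8p2 {V : Type*} [NormedAddCommGroup V] [InnerProductSpace ℝ V]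
    [FiniteDimensional ℝ V] [MeasurableSpace V] [BorelSpace V] (H : Pizza.Arrangement V) :
    (∀ a : V,
      (∀ R₁ R₂ : ℝ, ‖a‖ ≤ R₁ → ‖a‖ ≤ R₂ →
        H.pizzaQuantity (Metric.closedBall a R₁) = H.pizzaQuantity (Metric.closedBall a R₂)) →
      ∀ R : ℝ, ‖a‖ ≤ R → ¬ (finrank ℝ V = 1 ∧ R = ‖a‖ ∧ a ≠ 0) →
        H.AlternatingSurfaceSumVanishes a R) ∧
    (H.ParityCondition →
      ∀ E' : Finset V, E' ⊆ H.normals → Pizza.IsCoxeter E' →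
        (∀ w ∈ Pizza.reflectionGroup E', Pizza.Preserves w H.normals) →
        finrank ℝ V ≤ E'.card →
        ∀ (a : V) (R : ℝ), ‖a‖ ≤ R → ¬ (finrank ℝ V = 1 ∧ R = ‖a‖ ∧ a ≠ 0) →
          H.AlternatingSurfaceSumVanishes a R) := by
  refine ⟨fun a hconst R hR hdeg =>
    Pizza.Arrangement.alternatingSurfaceSumVanishes_of_pizzaQuantity_const hconst hR hdeg,
    fun hpar E' hE' _ hW hcard a R hR hdeg => ?_⟩
  rcases subsingleton_or_nontrivial V with hV | hV
  · exact H.alternatingSurfaceSumVanishes_of_subsingleton a R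
  refine Pizza.Arrangement.alternatingSurfaceSumVanishes_of_pizzaQuantity_const
    (fun R₁ R₂ h₁ h₂ => Pizza.Arrangement.pizzaQuantity_closedBall_const hpar hE'
      (fun e he => hW _ (Subgroup.subset_closure ⟨e, he, rfl⟩)) hcard h₁ h₂) hR hdeg
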